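/- Setting. Let $\mathcal X\subset\mathbb R^d$ be bounded with diameter $\operatorname{diam}(\mathcal X)$ (in the application $d=2$), let $f:\mathbb R^d\to\mathbb R$ be the true function, and let $\bar k$ be a shift-invariant kernel on $\mathbb R^d$ with $\bar k(x,x)=1$ and $\bar k\le 1$, that is the Fourier transform of a probability measure $\rho$ on $\mathbb R^d$ with $\sigma_*^2:=\int\|v\|^2\,d\rho(v)<\infty$. Let $\sigma_\theta>0$, $k^*=\sigma_\theta^2\bar k$, and let $\mathcal H^*$ be the reproducing kernel Hilbert space of $k^*$. For $D\ge1$ let $\mathbf v=(v_1,\dots,v_D)$ be i.i.d. with law $\rho$ and $$\phi_{\mathbf v}(x)=\tfrac1{\sqrt D}\,[\sin(v_1^\top x),\cos(v_1^\top x),\dots,\sin(v_D^\top x),\cos(v_D^\top x)]^\top\in\mathbb R^{2D}.$$ The loss is a negative log-likelihood $\mathcal L(z;y)=-\log p(y\mid z)$. The O-RFGP predictor is the online Bayesian predictor for the model $z=\phi_{\mathbf v}(x)^\top\theta$ with prior $\theta\sim N(0,\sigma_\theta^2I_{2D})$: the posterior of $\theta$ is updated by Bayes' rule after each observation $y_t=f(x_t)$,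 and the loss of the predictor at time $t$ is $$\mathcal L^{\mathrm B}_t:=-\log p(y_t\mid y_1,\dots,y_{t-1})=-\log\int e^{-\mathcal L(\phi_{\mathbf v}(x_t)^\top\theta;\,y_t)}\,p(d\theta\mid y_1,\dots,y_{t-1}).$$ Assumptions. Let $c_4,L,C$ be real constants such that, for every $x\in\mathcal X$, the function $z\mapsto\mathcal L(z;f(x))$ is convex and twice continuously differentiable, its second derivative is bounded in absolute value by $c_4$ on $\mathbb R$, and its first derivative is bounded in absolute value by $L$ for $|z|\le C$. Conclusions. (i) For all $T$, all inputs $x_1,\dots,x_T$ and every $\hat f\in\mathcal H^*$ (in particular an optimal one) there are coefficients $\hat\alpha_1,\dots,\hat\alpha_T$ with $$\hat f(x_t)=\sum_{s=1}^T\hat\alpha_s k^*(x_t,x_s)\quad(t=1,\dots,T).\qquad(*)$$ (ii) For all $D\ge1$ and $\varepsilon_2>0$, with probability at least $$1-2^8\Big(\frac{\sigma_*\operatorname{diam}(\mathcal X)}{\varepsilon_2}\Big)^2\exp\Big(\frac{-D\varepsilon_2^2}{4d+8}\Big)$$ over $\mathbf v$, simultaneously for all $T$, all $x_1,\dots,x_T\in\mathcal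 X$ and all $\hat f\in\mathcal H^*$ and $\hat\alpha$ with $(*)$ and $\sum_{s=1}^T\sigma_\theta^2|\hat\alpha_s|\le C$, $$\sum_{t=1}^T\mathcal L^{\mathrm B}_t-\sum_{t=1}^T\mathcal L(\hat f(x_t);f(x_t))\le\frac{(1+\varepsilon_2)C^2}{2\sigma_\theta^2}+D\log\Big(1+\frac{Tc_4\sigma_\theta^2}{2D}\Big)+\varepsilon_2LTC.$$ (iii) If $\varepsilon_2=\varepsilon_2(T)>0$ satisfies $\varepsilon_2(T)=\mathcal O(\log T/T)$, then the prediction regret is $\mathcal O(\log T)$: there is $K$, independent of $D$, $T$, $\mathbf v$, the inputs and the comparator, such that for all $D\ge1$ and $T\ge2$, with at least the probability in (ii) for $\varepsilon_2=\varepsilon_2(T)$, simultaneously for all $x_1,\dots,x_T\in\mathcal X$ and all $\hat f,\hat\alpha$ as in (ii), both $$\sum_{t=1}^T\mathcal L^{\mathrm B}_t-\sum_{t=1}^T\mathcal L(\hat f(x_t);f(x_t))\quad\text{and}\quad\sum_{t=1}^T\mathcal L^{\mathrm B}_t-\sum_{t=1}^T\mathcal L(\phi_{\mathbf v}(x_t)^\top\theta^*;f(x_t)),\qquad\theta^*=\sigma_\theta^2\sum_{s=1}^T\hat\alpha_s\phi_{\mathbf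 v}(x_s),$$ are at most $K\,D\log T$. (iv) For the Gaussian likelihood $p(y\mid z)=N(y;z,\sigma_n^2)$, $\sigma_n>0$, and arbitrary inputs and observations $y_t$, the predictor is given by the recursion $\theta_0=0$, $\Sigma_0=\sigma_\theta^2I_{2D}$, $\phi_t=\phi_{\mathbf v}(x_t)$, $\mu_t=\phi_t^\top\theta_{t-1}$, $s_t=\phi_t^\top\Sigma_{t-1}\phi_t+\sigma_n^2$, $\theta_t=\theta_{t-1}+s_t^{-1}\Sigma_{t-1}\phi_t(y_t-\mu_t)$, $\Sigma_t=\Sigma_{t-1}-s_t^{-1}\Sigma_{t-1}\phi_t\phi_t^\top\Sigma_{t-1}$: $$\mathcal L^{\mathrm B}_t=\frac{(y_t-\mu_t)^2}{2s_t}+\frac12\log(2\pi s_t).$$ -/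

import Mathlib

open MeasureTheory ProbabilityTheory Filter Asymptotics
open scoped Matrix RealInnerProductSpace

namespace RFGP

noncomputable section

/-- The input space `ℝ^d` with its Euclidean norm. -/
abbrev Pt (d : ℕ) : Type := EuclideanSpace ℝ (Fin d)

/-- Coordinates of the `2D`-dimensional weight and feature vectors: the pair `(i, 0)` carries the
sine and the pair `(i, 1)` the cosine belonging to the `i`-th frequency. -/
abbrev Idx (D : ℕ) : Type := Fin D × Fin 2

/-- The random feature vector
`φ_v(x) = D^{-1/2} (sin (v₁ᵀx), cos (v₁ᵀx), …, sin (v_Dᵀx), cos (v_Dᵀx))`. -/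
def feature {d D : ℕ} (v : Fin D → Pt d) (x : Pt d) : Idx D → ℝ :=
  fun i => (if i.2 = 0 then Real.sin ⟪v i.1, x⟫ else Real.cos ⟪v i.1, x⟫) / √(D : ℝ)

/-- The law of `D` independent frequencies, each distributed as `ρ`. -/
def freqLaw {d : ℕ} (ρ : Measure (Pt d)) (D : ℕ) : Measure (Fin D → Pt d) :=
  Measure.pi fun _ => ρ

/-- `σ_* = (E ‖v‖²)^{1/2}` for a frequency `v` with law `ρ`. -/
def freqRms {d : ℕ} (ρ : Measure (Pt d)) : ℝ := √(∫ v, ‖v‖ ^ 2 ∂ρ)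

/-- The prior `N(0, σθ² I_{2D})` of the weight vector `θ`. -/
def prior (D : ℕ) (σθ : ℝ) : Measure (Idx D → ℝ) :=
  Measure.pi fun _ => gaussianReal 0 (σθ ^ 2).toNNReal

/-- The posterior of `θ` after `t` observations `(x 0, y 0), …, (x (t-1), y (t-1))`, computed
online by Bayes' rule. Here `ℓ z y` is the negative log-likelihood `-log p(y | z)` of the
observation `y` when the value of the function is `z = φ_v(x)ᵀθ`, so that each new observation
multiplies the density by `exp (-ℓ (φ_v(x)ᵀθ) y)` and renormalizes. -/
def posterior {d D : ℕ} (ℓ : ℝ → ℝ → ℝ) (σθ : ℝ) (v : Fin D → Pt d) (x : ℕ → Pt d) (y : ℕ → ℝ) :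
    ℕ → Measure (Idx D → ℝ)
  | 0 => prior D σθ
  | t + 1 => (posterior ℓ σθ v x y t).tilted fun θ => -ℓ (feature v (x t) ⬝ᵥ θ) (y t)

/-- The loss of the online predictor at time `t`: the negative logarithm
`-log p(y t | y 0, …, y (t-1))` of its one-step-ahead predictive density
`∫ p(y t | φ_v(x t)ᵀθ) d(posterior)(θ)`. -/
def bayesLoss {d D : ℕ} (ℓ : ℝ → ℝ → ℝ) (σθ : ℝ) (v : Fin D → Pt d) (x : ℕ → Pt d) (y : ℕ → ℝ)
    (t : ℕ) : ℝ :=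
  -Real.log (∫ θ, Real.exp (-ℓ (feature v (x t) ⬝ᵥ θ) (y t)) ∂(posterior ℓ σθ v x y t))

/-- The weight vector `θ^* = σθ² ∑_{s<T} α_s φ_v(x_s)` of the random feature approximation of the
kernel expansion `∑_{s<T} α_s σθ² k̄(·, x_s)`. -/
def rfWeight {d D : ℕ} (σθ : ℝ) (v : Fin D → Pt d) (x : ℕ → Pt d) (α : ℕ → ℝ) (T : ℕ) :
    Idx D → ℝ :=
  σθ ^ 2 • ∑ s ∈ Finset.range T, α s • feature v (x s)

/-- The Gaussian negative log-likelihood with noise variance `σn²`. -/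
def gaussianLoss (σn : ℝ) (z y : ℝ) : ℝ :=
  (y - z) ^ 2 / (2 * σn ^ 2) + Real.log (2 * Real.pi * σn ^ 2) / 2

/-- The predictive variance `φ_v(x)ᵀ Σ φ_v(x) + σn²` of an observation at `x`. -/
def predVar {d D : ℕ} (σn : ℝ) (v : Fin D → Pt d) (S : Matrix (Idx D) (Idx D) ℝ) (x : Pt d) : ℝ :=
  feature v x ⬝ᵥ (S *ᵥ feature v x) + σn ^ 2

/-- The parameters `(θ_t, Σ_t)` of the online random feature Gaussian process with Gaussian noise
after `t` observations, computed by the recursive (rank-one) update from `(0, σθ² I)`. -/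
def orfgp {d D : ℕ} (σθ σn : ℝ) (v : Fin D → Pt d) (x : ℕ → Pt d) (y : ℕ → ℝ) :
    ℕ → (Idx D → ℝ) × Matrix (Idx D) (Idx D) ℝ
  | 0 => (0, σθ ^ 2 • (1 : Matrix (Idx D) (Idx D) ℝ))
  | t + 1 =>
    let θ := (orfgp σθ σn v x y t).1
    let S := (orfgp σθ σn v x y t).2
    let φ := feature v (x t)
    let s := predVar σn v S (x t)
    (θ + (s⁻¹ * (y t - φ ⬝ᵥ θ)) • (S *ᵥ φ), S - s⁻¹ • Matrix.vecMulVec (S *ᵥ φ) (φ ᵥ* S))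

/-- The failure probability `2⁸ (σ_* diam / ε)² exp (-D ε² / (4 d + 8))`. -/
def failProb {d : ℕ} (ρ : Measure (Pt d)) (𝒳 : Set (Pt d)) (D : ℕ) (ε : ℝ) : ℝ :=
  2 ^ 8 * (freqRms ρ * Metric.diam 𝒳 / ε) ^ 2 * Real.exp (-(D * ε ^ 2) / (4 * d + 8))

end

end RFGP

namespace RFGP

variable {d D : ℕ}

/-! The cumulative Bayesian loss telescopes to `-log ∫ exp(-G) dP`, with `P` the Gaussian prior and
`G` the total loss of a weight vector (`sum_bayesLoss_eq`). Passing to `Q = N(m, τ² I)` and applying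
Jensen bounds this by `∫ G dQ + KL(Q‖P)`. Bounded curvature and unit-norm features give `∫ G dQ ≤
G(m) + T c τ² / 2`. A suitable `τ` cancels everything except `‖m‖² / (2σ²)` and the logarithm
(`neg_log_integral_exp_neg_sum_le`).

Take `m = θ^*`. Feature inner products are at most 1 in absolute value, so `‖θ^*‖² ≤ C²` for every
`v`. If the empirical kernel is uniformly `ε`-close to `kbar` on differences of inputs, the
predictions of `θ^*` and `fhat` differ by at most `C ε` and both lie in `[-C, C]`, where the loss is
`L`-Lipschitz. Chance enters only through this closeness, an event in `v` alone; hence the bounds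
hold simultaneously for all inputs and comparators.

The probability estimate `measure_exists_kernelDev_gt_le` combines a cover, Hoeffding at its centres
and Markov for the random Lipschitz constant. When the ball is small relative to `ε`, a direct
exponential moment bound replaces the cover.

The expansion of `fhat` is orthogonal projection onto kernel sections. The Gaussian recursion is
Bayes' rule read off from characteristic functions. -/

lemma feature_dotProduct (v : Fin D → Pt d) (x x' : Pt d) :
    feature v x ⬝ᵥ feature v x' = (∑ i, Real.cos ⟪v i, x - x'⟫) / D := by
  have h : √(D : ℝ) * √(D : ℝ) = D := Real.mul_self_sqrt (Nat.cast_nonneg D)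
  simp only [dotProduct, feature, Fintype.sum_prod_type, Fin.sum_univ_two, Finset.sum_div]
  refine Finset.sum_congr rfl fun i _ => ?_
  simp only [if_true, one_ne_zero, if_false, div_mul_div_comm, h, inner_sub_right, Real.cos_sub]
  ring

lemma feature_dotProduct_self (hD : 1 ≤ D) (v : Fin D → Pt d) (x : Pt d) :
    feature v x ⬝ᵥ feature v x = 1 := by
  have : (D : ℝ) ≠ 0 := by positivity
  simp [feature_dotProduct, this]

lemma abs_feature_dotProduct_le_one (v : Fin D → Pt d) (x x' : Pt d) :
    |feature v x ⬝ᵥ feature v x'| ≤ 1 := by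
  rw [feature_dotProduct, abs_div, Nat.abs_cast]
  refine div_le_one_of_le₀ ?_ (Nat.cast_nonneg D)
  refine (Finset.abs_sum_le_sum_abs _ _).trans ?_
  refine (Finset.sum_le_sum fun i _ => Real.abs_cos_le_one _).trans ?_
  simp

lemma charFun_re {ρ : Measure (Pt d)} [IsProbabilityMeasure ρ] (t : Pt d) :
    (charFun ρ t).re = ∫ w, Real.cos ⟪w, t⟫ ∂ρ := by
  rw [charFun_apply, ← RCLike.re_eq_complex_re, ← integral_re]
  · refine integral_congr_ae (ae_of_all _ fun w => ?_)
    simp [Complex.exp_ofReal_mul_I_re]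
  · refine Integrable.of_bound (C := 1) (by fun_prop) (ae_of_all _ fun w => ?_)
    simp [Complex.norm_exp_ofReal_mul_I]

lemma kernel_eq_integral_cos {kbar : Pt d → Pt d → ℝ} {ρ : Measure (Pt d)}
    [IsProbabilityMeasure ρ] (hspec : ∀ x x', charFun ρ (x - x') = (kbar x x' : ℂ))
    (x x' : Pt d) : kbar x x' = ∫ w, Real.cos ⟪w, x - x'⟫ ∂ρ := by
  rw [← charFun_re, hspec, Complex.ofReal_re]

lemma abs_kernel_le_one {kbar : Pt d → Pt d → ℝ} {ρ : Measure (Pt d)}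
    [IsProbabilityMeasure ρ] (hspec : ∀ x x', charFun ρ (x - x') = (kbar x x' : ℂ))
    (x x' : Pt d) : |kbar x x'| ≤ 1 := by
  have h := norm_charFun_le_one (μ := ρ) (x - x')
  rwa [hspec, Complex.norm_real] at h

/-- Every element of a scalar-valued reproducing kernel Hilbert space agrees at finitely many
points with a kernel expansion at these points. -/
lemma exists_kernel_expansion {X H : Type*} [NormedAddCommGroup H] [InnerProductSpace ℝ H]
    [CompleteSpace H] [RKHS ℝ H X ℝ] (T : ℕ) (x : ℕ → X) (f : H) :
    ∃ α : ℕ → ℝ, ∀ t < T,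
      f (x t) = ∑ s ∈ Finset.range T, α s * RKHS.kernel H (x t) (x s) 1 := by
  classical
  set b : ℕ → H := fun s => RKHS.kerFun H (x s) 1 with hb
  set W := Submodule.span ℝ (b '' (Finset.range T : Set ℕ)) with hW
  have : FiniteDimensional ℝ W :=
    FiniteDimensional.span_of_finite ℝ ((Finset.finite_toSet _).image _)
  obtain ⟨g, hg, g', hg', rfl⟩ := W.exists_add_mem_mem_orthogonal f
  obtain ⟨β, rfl⟩ := (Submodule.mem_span_image_finset_iff_exists_fun ℝ).1 hg
  set α : ℕ → ℝ := fun s => if h : s ∈ Finset.range T then β ⟨s, h⟩ else 0 with hα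
  have hβ : ∑ i : ↥(Finset.range T), β i • b i.1 = ∑ s ∈ Finset.range T, α s • b s := by
    refine (Fintype.sum_congr _ _ fun i => ?_).trans
      (Finset.sum_coe_sort (Finset.range T) fun s => α s • b s)
    simp only [hα, i.2, dif_pos]
  rw [hβ] at *
  refine ⟨α, fun t ht => ?_⟩
  -- By the reproducing property, orthogonality to the section at `x t` means vanishing there.
  have h0 : g' (x t) = 0 := by
    have := (Submodule.mem_orthogonal W g').1 hg' (b t)
      (Submodule.subset_span ⟨t, by simpa using ht, rfl⟩)
    simpa [hb] using this
  rw [RKHS.coe_add, Pi.add_apply, h0, add_zero]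
  have : ∀ S : Finset ℕ, (∑ s ∈ S, α s • b s) (x t)
      = ∑ s ∈ S, α s * RKHS.kernel H (x t) (x s) 1 := by
    intro S
    induction S using Finset.induction_on with
    | empty => simp
    | insert a S ha ih =>
      rw [Finset.sum_insert ha, Finset.sum_insert ha, RKHS.coe_add, Pi.add_apply, ih,
        RKHS.coe_smul, Pi.smul_apply, hb, RKHS.kerFun_apply, smul_eq_mul]
  exact this _

/-! ### Gaussian likelihood and the recursive update -/

open Complex in
-- The square-root prefactor is moved into the exponent as a logarithm, so that later identities
-- only compare exponents.
lemma integral_cexp_quadratic_div_two_pi {s : ℝ} (hs : 0 < s) (c e : ℂ) :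
    (2 * Real.pi : ℂ)⁻¹ * ∫ w : ℝ, cexp (-(s / 2 : ℂ) * w ^ 2 + c * w + e)
      = cexp (c ^ 2 / (2 * s) + e - (Real.log (2 * Real.pi * s) / 2 : ℝ)) := by
  have hpi := Real.pi_pos
  have hs' : (s : ℂ) ≠ 0 := by exact_mod_cast hs.ne'
  rw [integral_cexp_quadratic (by simp [hs])]
  have h1 : ((Real.pi : ℂ) / - -(s / 2 : ℂ)) ^ (1 / 2 : ℂ)
      = cexp ((Real.log (2 * Real.pi / s) / 2 : ℝ)) := by
    have : ((Real.pi : ℂ) / - -(s / 2 : ℂ)) = ((2 * Real.pi / s : ℝ) : ℂ) := by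
      push_cast; field_simp
    rw [this, show (1 / 2 : ℂ) = ((1 / 2 : ℝ) : ℂ) by push_cast; rfl,
      ← ofReal_cpow (by positivity), Real.rpow_def_of_pos (by positivity), ofReal_exp]
    congr 3
    ring
  have h2 : (2 * Real.pi : ℂ)⁻¹ = cexp ((-Real.log (2 * Real.pi) : ℝ)) := by
    rw [← ofReal_exp, Real.exp_neg, Real.exp_log (by positivity)]
    push_cast; rfl
  rw [h1, h2, ← exp_add, ← exp_add]
  congr 1
  rw [Real.log_div (by positivity) (by positivity),
    Real.log_mul (x := 2 * Real.pi) (y := s) (by positivity) (by positivity)]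
  push_cast
  field_simp
  ring

open Complex in
-- Fourier inversion for the normal density. It makes `z` enter the exponent linearly, so
-- integrating over the weights only requires their characteristic function.
lemma exp_neg_gaussianLoss {σn : ℝ} (hσn : 0 < σn) (z y : ℝ) :
    (Real.exp (-gaussianLoss σn z y) : ℂ)
      = (2 * Real.pi : ℂ)⁻¹ *
        ∫ w : ℝ, cexp (-((σn ^ 2 : ℝ) / 2 : ℂ) * w ^ 2 + (I * (z - y)) * w + 0) := by
  rw [integral_cexp_quadratic_div_two_pi (by positivity), ofReal_exp]
  congr 1
  have : (σn : ℂ) ≠ 0 := by exact_mod_cast hσn.ne'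
  rw [gaussianLoss, mul_pow, I_sq]
  push_cast
  ring

section

variable {ι : Type*} [Fintype ι]

/-- A probability measure whose characteristic function is that of the normal distribution with
mean `m` and covariance `S`. -/
structure IsNormal (μ : Measure (ι → ℝ)) (m : ι → ℝ) (S : Matrix ι ι ℝ) : Prop where
  prob : IsProbabilityMeasure μ
  symm : Sᵀ = S
  cf : ∀ a : ι → ℝ, ∫ θ, Complex.exp (Complex.I * (a ⬝ᵥ θ : ℝ)) ∂μ
    = Complex.exp (Complex.I * (a ⬝ᵥ m : ℝ) - (a ⬝ᵥ (S *ᵥ a) : ℝ) / 2)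

lemma continuous_dotProduct_left (a : ι → ℝ) : Continuous fun θ : ι → ℝ => a ⬝ᵥ θ := by
  unfold dotProduct
  fun_prop

/-- A characteristic function has modulus at most 1, and here the modulus is `exp(-aᵀSa / 2)`. This
keeps the predictive variance positive without a separate invariant of the recursion. -/
lemma IsNormal.quadForm_nonneg {μ : Measure (ι → ℝ)} {m : ι → ℝ} {S : Matrix ι ι ℝ}
    (h : IsNormal μ m S) (a : ι → ℝ) : 0 ≤ a ⬝ᵥ (S *ᵥ a) := by
  have := h.prob
  have h1 : ‖∫ θ, Complex.exp (Complex.I * (a ⬝ᵥ θ : ℝ)) ∂μ‖ ≤ 1 := by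
    refine (norm_integral_le_of_norm_le_const (C := 1) (ae_of_all _ fun θ => ?_)).trans ?_
    · rw [mul_comm, Complex.norm_exp_ofReal_mul_I]
    · simp
  rw [h.cf, Complex.norm_exp] at h1
  have h2 := Real.exp_le_one_iff.1 h1
  simp at h2
  linarith

lemma dotProduct_mulVec_comm {S : Matrix ι ι ℝ} (hS : Sᵀ = S) (a b : ι → ℝ) :
    a ⬝ᵥ (S *ᵥ b) = b ⬝ᵥ (S *ᵥ a) := by
  rw [Matrix.dotProduct_mulVec, ← Matrix.mulVec_transpose, hS, dotProduct_comm]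

/-- Integrals of characters against a normal distribution weighted by a Gaussian likelihood of
the linear functional `φ`. -/
lemma IsNormal.integral_cexp_mul_exp_neg_gaussianLoss {μ : Measure (ι → ℝ)} {m : ι → ℝ}
    {S : Matrix ι ι ℝ} (h : IsNormal μ m S) {σn : ℝ} (hσn : 0 < σn) (φ a : ι → ℝ) (y : ℝ) :
    let s := φ ⬝ᵥ (S *ᵥ φ) + σn ^ 2
    ∫ θ, Complex.exp (Complex.I * (a ⬝ᵥ θ : ℝ)) * (Real.exp (-gaussianLoss σn (φ ⬝ᵥ θ) y) : ℂ) ∂μ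
      = Complex.exp (-((y - φ ⬝ᵥ m) ^ 2 / (2 * s) + Real.log (2 * Real.pi * s) / 2 : ℝ)) *
        Complex.exp (Complex.I * (a ⬝ᵥ (m + (s⁻¹ * (y - φ ⬝ᵥ m)) • (S *ᵥ φ)) : ℝ)
          - (a ⬝ᵥ ((S - s⁻¹ • Matrix.vecMulVec (S *ᵥ φ) (φ ᵥ* S)) *ᵥ a) : ℝ) / 2) := by
  intro s
  have hprob := h.prob
  have hs : 0 < s := by have := h.quadForm_nonneg φ; positivity
  have hsn : 0 < σn ^ 2 := by positivity
  have hs' : (s : ℂ) ≠ 0 := by exact_mod_cast hs.ne'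
  set F : (ι → ℝ) → ℝ → ℂ := fun θ w => Complex.exp (-((σn ^ 2 : ℝ) / 2 : ℂ) * w ^ 2
    + (Complex.I * (a ⬝ᵥ θ : ℝ) + (Complex.I * ((φ ⬝ᵥ θ : ℝ) - y)) * w)) with hF
  -- The modulus of `F` is a Gaussian in `w` that does not depend on `θ`, so Fubini applies.
  have hint : Integrable (Function.uncurry F) (μ.prod volume) := by
    have h1 : Integrable (fun w : ℝ => Real.exp (-(σn ^ 2 / 2) * w ^ 2)) :=
      integrable_exp_neg_mul_sq (by positivity)
    have h2 : Integrable (fun p : (ι → ℝ) × ℝ => Real.exp (-(σn ^ 2 / 2) * p.2 ^ 2))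
        (μ.prod volume) := h1.comp_snd μ
    refine h2.mono' ?_ (ae_of_all _ fun p => ?_)
    · have := continuous_dotProduct_left a
      have := continuous_dotProduct_left φ
      refine Continuous.aestronglyMeasurable ?_
      simp only [hF, Function.uncurry_def]
      fun_prop
    · simp only [hF, Function.uncurry_def, Complex.norm_exp]
      refine le_of_eq (congrArg _ ?_)
      simp [← Complex.ofReal_pow]
  calc _ = ∫ θ, (2 * Real.pi : ℂ)⁻¹ * (∫ w : ℝ, F θ w) ∂μ := by
        refine integral_congr_ae (ae_of_all _ fun θ => ?_)
        simp only
        rw [exp_neg_gaussianLoss hσn, mul_left_comm, ← integral_const_mul]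
        congr 2
        ext w
        rw [← Complex.exp_add, hF]
        congr 1
        ring
    _ = (2 * Real.pi : ℂ)⁻¹ * ∫ w : ℝ, ∫ θ, F θ w ∂μ := by
        rw [integral_const_mul, integral_integral_swap hint]
    _ = (2 * Real.pi : ℂ)⁻¹ * ∫ w : ℝ, Complex.exp (-(s / 2 : ℂ) * w ^ 2
          + (Complex.I * ((φ ⬝ᵥ m : ℝ) - y) - (a ⬝ᵥ (S *ᵥ φ) : ℝ)) * w
          + (Complex.I * (a ⬝ᵥ m : ℝ) - (a ⬝ᵥ (S *ᵥ a) : ℝ) / 2)) := by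
        congr 2
        ext w
        have h1 : ∀ θ, F θ w = Complex.exp (-((σn ^ 2 : ℝ) / 2 : ℂ) * w ^ 2 - Complex.I * y * w) *
            Complex.exp (Complex.I * ((a + w • φ) ⬝ᵥ θ : ℝ)) := by
          intro θ
          rw [hF, ← Complex.exp_add, add_dotProduct, smul_dotProduct]
          push_cast [smul_eq_mul]
          ring_nf
        simp_rw [h1]
        rw [integral_const_mul, h.cf, ← Complex.exp_add]
        congr 1
        rw [Matrix.mulVec_add, Matrix.mulVec_smul, add_dotProduct, add_dotProduct, dotProduct_add,
          dotProduct_add]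
        simp only [smul_dotProduct, dotProduct_smul, smul_eq_mul,
          dotProduct_mulVec_comm h.symm φ a, s]
        push_cast
        ring
    _ = _ := by
        -- Expanding the square of the linear coefficient over `2 s` gives three terms: the
        -- predictive loss, the mean shift and the rank-one covariance correction.
        rw [integral_cexp_quadratic_div_two_pi hs, ← Complex.exp_add]
        congr 1
        have e1 : φ ᵥ* S = S *ᵥ φ := by rw [← Matrix.mulVec_transpose, h.symm]
        rw [e1, Matrix.sub_mulVec, Matrix.smul_mulVec, Matrix.vecMulVec_mulVec, dotProduct_sub,
          dotProduct_add]
        simp only [dotProduct_smul, smul_eq_mul, op_smul_eq_smul,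
          dotProduct_comm (S *ᵥ φ) a]
        push_cast
        field_simp
        ring_nf
        simp only [Complex.I_sq]
        ring

/-- Bayes' rule for a normal prior and a Gaussian likelihood. -/
lemma IsNormal.tilted_gaussianLoss {μ : Measure (ι → ℝ)} {m : ι → ℝ}
    {S : Matrix ι ι ℝ} (h : IsNormal μ m S) {σn : ℝ} (hσn : 0 < σn) (φ : ι → ℝ) (y : ℝ) :
    let s := φ ⬝ᵥ (S *ᵥ φ) + σn ^ 2
    ∫ θ, Real.exp (-gaussianLoss σn (φ ⬝ᵥ θ) y) ∂μ
      = Real.exp (-((y - φ ⬝ᵥ m) ^ 2 / (2 * s) + Real.log (2 * Real.pi * s) / 2)) ∧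
    IsNormal (μ.tilted fun θ => -gaussianLoss σn (φ ⬝ᵥ θ) y)
      (m + (s⁻¹ * (y - φ ⬝ᵥ m)) • (S *ᵥ φ))
      (S - s⁻¹ • Matrix.vecMulVec (S *ᵥ φ) (φ ᵥ* S)) := by
  intro s
  have hprob := h.prob
  have hZ : ∫ θ, Real.exp (-gaussianLoss σn (φ ⬝ᵥ θ) y) ∂μ
      = Real.exp (-((y - φ ⬝ᵥ m) ^ 2 / (2 * s) + Real.log (2 * Real.pi * s) / 2)) := by
    have := h.integral_cexp_mul_exp_neg_gaussianLoss hσn φ 0 y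
    simp only [zero_dotProduct, Complex.ofReal_zero, mul_zero, zero_div, sub_zero,
      Complex.exp_zero, one_mul, mul_one, integral_complex_ofReal] at this
    rw [← Complex.ofReal_neg, ← Complex.ofReal_exp] at this
    exact_mod_cast this
  refine ⟨hZ, ?_, ?_, fun a => ?_⟩
  · refine isProbabilityMeasure_tilted ?_
    -- A non-integrable weight would have integral 0, but the integral is a positive exponential.
    by_contra hni
    rw [integral_undef hni] at hZ
    exact (Real.exp_pos _).ne hZ
  · have e1 : φ ᵥ* S = S *ᵥ φ := by rw [← Matrix.mulVec_transpose, h.symm]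
    rw [Matrix.transpose_sub, Matrix.transpose_smul, h.symm, e1, Matrix.transpose_vecMulVec]
  · rw [integral_tilted]
    simp only [hZ]
    have h2 := h.integral_cexp_mul_exp_neg_gaussianLoss hσn φ a y
    have h3 : ∀ θ, (Real.exp (-gaussianLoss σn (φ ⬝ᵥ θ) y) /
        Real.exp (-((y - φ ⬝ᵥ m) ^ 2 / (2 * s) + Real.log (2 * Real.pi * s) / 2))) •
          Complex.exp (Complex.I * (a ⬝ᵥ θ : ℝ))
        = (Real.exp (-((y - φ ⬝ᵥ m) ^ 2 / (2 * s) + Real.log (2 * Real.pi * s) / 2)) : ℂ)⁻¹ *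
          (Complex.exp (Complex.I * (a ⬝ᵥ θ : ℝ)) *
            (Real.exp (-gaussianLoss σn (φ ⬝ᵥ θ) y) : ℂ)) := by
      intro θ
      rw [Complex.real_smul]
      push_cast
      ring
    simp_rw [h3]
    rw [integral_const_mul, h2, ← mul_assoc, Complex.ofReal_exp, Complex.ofReal_neg,
      inv_mul_cancel₀ (Complex.exp_ne_zero _), one_mul]

lemma isNormal_pi_gaussianReal [DecidableEq ι] (σ : ℝ) :
    IsNormal (Measure.pi fun _ : ι => gaussianReal 0 (σ ^ 2).toNNReal) 0
      (σ ^ 2 • (1 : Matrix ι ι ℝ)) := by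
  refine ⟨inferInstance, by simp, fun a => ?_⟩
  have h1 : ∀ θ : ι → ℝ, Complex.exp (Complex.I * (a ⬝ᵥ θ : ℝ))
      = ∏ i, Complex.exp (a i * θ i * Complex.I) := by
    intro θ
    rw [← Complex.exp_sum, dotProduct, mul_comm, Complex.ofReal_sum, Finset.sum_mul]
    push_cast
    rfl
  simp_rw [h1]
  rw [integral_fintype_prod_eq_prod (f := fun i (t : ℝ) => Complex.exp (a i * t * Complex.I))]
  simp_rw [← charFun_apply_real, charFun_gaussianReal, ← Complex.exp_sum]
  congr 1
  simp only [Matrix.smul_mulVec, Matrix.one_mulVec, dotProduct, Pi.zero_apply, Pi.smul_apply,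
    Real.coe_toNNReal _ (sq_nonneg σ), smul_eq_mul, mul_zero, Finset.sum_const_zero]
  push_cast
  rw [Finset.sum_div, mul_zero, zero_sub, ← Finset.sum_neg_distrib]
  refine Finset.sum_congr rfl fun i _ => ?_
  ring

end

variable {d D : ℕ}

lemma isNormal_posterior_gaussianLoss {σn : ℝ} (hσn : 0 < σn) (σθ : ℝ) (v : Fin D → Pt d)
    (x : ℕ → Pt d) (y : ℕ → ℝ) (t : ℕ) :
    IsNormal (posterior (gaussianLoss σn) σθ v x y t) (orfgp σθ σn v x y t).1
      (orfgp σθ σn v x y t).2 := by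
  induction t with
  | zero => exact isNormal_pi_gaussianReal σθ
  | succ t ih => exact (ih.tilted_gaussianLoss hσn (feature v (x t)) (y t)).2

lemma bayesLoss_gaussianLoss {σn : ℝ} (hσn : 0 < σn) (σθ : ℝ) (v : Fin D → Pt d)
    (x : ℕ → Pt d) (y : ℕ → ℝ) (t : ℕ) :
    let μ := feature v (x t) ⬝ᵥ (orfgp σθ σn v x y t).1
    let s := predVar σn v (orfgp σθ σn v x y t).2 (x t)
    bayesLoss (gaussianLoss σn) σθ v x y t
      = (y t - μ) ^ 2 / (2 * s) + Real.log (2 * Real.pi * s) / 2 := by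
  intro μ s
  rw [bayesLoss, ((isNormal_posterior_gaussianLoss hσn σθ v x y t).tilted_gaussianLoss hσn
    (feature v (x t)) (y t)).1, Real.log_exp, neg_neg]
  rfl

/-! ### Tangent and quadratic bounds -/

section Calculus

lemma convexOn_tangent_le {g : ℝ → ℝ} (hg : ConvexOn ℝ Set.univ g) {a : ℝ}
    (hd : DifferentiableAt ℝ g a) (z : ℝ) : g a + deriv g a * (z - a) ≤ g z := by
  rcases lt_trichotomy a z with h | rfl | h
  · have := hg.deriv_le_slope (Set.mem_univ _) (Set.mem_univ _) h hd
    rw [slope_def_field, le_div_iff₀ (sub_pos.2 h)] at this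
    linarith
  · simp
  · have := hg.slope_le_deriv (Set.mem_univ _) (Set.mem_univ _) h hd
    rw [slope_def_field, div_le_iff₀ (sub_pos.2 h)] at this
    linarith

/-- The function `c/2 * w² - g w` is convex, and its tangent inequality at `a` is the claim. -/
lemma le_quadratic_of_deriv_two_le {g : ℝ → ℝ} {c : ℝ} (hg : ContDiff ℝ 2 g)
    (hc : ∀ z, |iteratedDeriv 2 g z| ≤ c) (a z : ℝ) :
    g z ≤ g a + deriv g a * (z - a) + c / 2 * (z - a) ^ 2 := by
  have hd : Differentiable ℝ g := hg.differentiable (by norm_num)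
  have hd' : Differentiable ℝ (deriv g) := hg.differentiable_deriv_two
  set k : ℝ → ℝ := fun w => c / 2 * w ^ 2 - g w with hk
  have h1 : ∀ w, HasDerivAt k (c * w - deriv g w) w := by
    intro w
    have := ((hasDerivAt_pow 2 w).const_mul (c / 2)).sub (hd w).hasDerivAt
    refine this.congr_deriv ?_
    simp; ring
  have h1' : deriv k = fun w => c * w - deriv g w := funext fun w => (h1 w).deriv
  have h2 : ∀ w, HasDerivAt (deriv k) (c - iteratedDeriv 2 g w) w := by
    intro w
    rw [h1']
    have := ((hasDerivAt_id w).const_mul c).sub (hd' w).hasDerivAt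
    refine this.congr_deriv ?_
    rw [iteratedDeriv_succ, iteratedDeriv_one, mul_one]
  have hconv : ConvexOn ℝ Set.univ k :=
    convexOn_univ_of_deriv2_nonneg (fun w => (h1 w).differentiableAt)
      (fun w => (h2 w).differentiableAt) fun w => by
        rw [Function.iterate_succ, Function.iterate_one, Function.comp_apply, (h2 w).deriv]
        linarith [le_abs_self (iteratedDeriv 2 g w), hc w]
  have := convexOn_tangent_le hconv (h1 a).differentiableAt z
  rw [h1', hk] at this
  simp only at this
  nlinarith [this]

end Calculus

/-! ### Change of measure between isotropic normal distributions -/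

section Density

variable {ι : Type*} [Fintype ι]

lemma pi_withDensity_ofReal {E : Type*} [MeasurableSpace E] (ν : ι → Measure E)
    [∀ i, IsProbabilityMeasure (ν i)] (f : ι → E → ℝ) (hf0 : ∀ i x, 0 ≤ f i x)
    (hf : ∀ i, Integrable (f i) (ν i))
    [∀ i, SigmaFinite ((ν i).withDensity fun x => ENNReal.ofReal (f i x))] :
    Measure.pi (fun i => (ν i).withDensity fun x => ENNReal.ofReal (f i x))
      = (Measure.pi ν).withDensity fun x => ENNReal.ofReal (∏ i, f i (x i)) := by
  refine Measure.pi_eq fun s hs => ?_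
  rw [withDensity_apply _ (MeasurableSet.univ_pi hs), Measure.restrict_pi_pi,
    ← ofReal_integral_eq_lintegral_ofReal, integral_fintype_prod_eq_prod,
    ENNReal.ofReal_prod_of_nonneg]
  · refine Finset.prod_congr rfl fun i _ => ?_
    rw [withDensity_apply _ (hs i), ofReal_integral_eq_lintegral_ofReal (hf i).restrict
      (ae_of_all _ (hf0 i))]
  · exact fun i _ => integral_nonneg (hf0 i)
  · exact Integrable.fintype_prod fun i => (hf i).restrict
  · exact ae_of_all _ fun x => Finset.prod_nonneg fun i _ => hf0 i _

/-- The logarithm of the density of `N(m, τ²)` with respect to `N(0, σ²)`. -/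
noncomputable def gaussianLogRatio (σ τ m t : ℝ) : ℝ :=
  t ^ 2 / (2 * σ ^ 2) - (t - m) ^ 2 / (2 * τ ^ 2) + Real.log (σ / τ)

lemma continuous_gaussianLogRatio (σ τ m : ℝ) : Continuous (gaussianLogRatio σ τ m) := by
  unfold gaussianLogRatio
  fun_prop

lemma gaussianReal_eq_withDensity {σ τ : ℝ} (hσ : 0 < σ) (hτ : 0 < τ) (m : ℝ) :
    gaussianReal 0 (σ ^ 2).toNNReal = (gaussianReal m (τ ^ 2).toNNReal).withDensity
      fun t => ENNReal.ofReal (Real.exp (-gaussianLogRatio σ τ m t)) := by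
  have h0 : ∀ {s : ℝ}, 0 < s → (s ^ 2).toNNReal ≠ 0 := fun {s} hs => by
    have : 0 < s ^ 2 := by positivity
    simpa using hs.ne'
  have hm : Measurable fun t => ENNReal.ofReal (Real.exp (-gaussianLogRatio σ τ m t)) :=
    ((continuous_gaussianLogRatio σ τ m).neg.rexp).measurable.ennreal_ofReal
  rw [gaussianReal_of_var_ne_zero _ (h0 hσ), gaussianReal_of_var_ne_zero _ (h0 hτ),
    ← withDensity_mul _ (measurable_gaussianPDF _ _) hm]
  congr 1
  ext t
  rw [Pi.mul_apply, gaussianPDF, gaussianPDF,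
    ← ENNReal.ofReal_mul (gaussianPDFReal_nonneg _ _ _)]
  congr 1
  rw [gaussianPDFReal, gaussianPDFReal, Real.coe_toNNReal _ (sq_nonneg σ),
    Real.coe_toNNReal _ (sq_nonneg τ), Real.sqrt_mul' _ (sq_nonneg σ),
    Real.sqrt_mul' _ (sq_nonneg τ), Real.sqrt_sq hσ.le, Real.sqrt_sq hτ.le, gaussianLogRatio,
    mul_assoc, ← Real.exp_add]
  have e : -(t - m) ^ 2 / (2 * τ ^ 2) + -(t ^ 2 / (2 * σ ^ 2) - (t - m) ^ 2 / (2 * τ ^ 2)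
      + Real.log (σ / τ)) = -Real.log (σ / τ) + -(t - 0) ^ 2 / (2 * σ ^ 2) := by ring
  rw [e, Real.exp_add, Real.exp_neg, Real.exp_log (by positivity)]
  have := Real.pi_pos
  field_simp

/-- The reweighted measure is a probability measure, so its density has total integral 1. -/
lemma integrable_exp_neg_gaussianLogRatio {σ τ : ℝ} (hσ : 0 < σ) (hτ : 0 < τ) (m : ℝ) :
    Integrable (fun t => Real.exp (-gaussianLogRatio σ τ m t))
      (gaussianReal m (τ ^ 2).toNNReal) := by
  have h1 : IsProbabilityMeasure ((gaussianReal m (τ ^ 2).toNNReal).withDensity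
      fun t => ENNReal.ofReal (Real.exp (-gaussianLogRatio σ τ m t))) := by
    rw [← gaussianReal_eq_withDensity hσ hτ]; infer_instance
  refine ⟨(continuous_gaussianLogRatio σ τ m).neg.rexp.aestronglyMeasurable, ?_⟩
  rw [hasFiniteIntegral_iff_ofReal (ae_of_all _ fun t => (Real.exp_pos _).le)]
  have := h1.measure_univ
  rw [withDensity_apply _ MeasurableSet.univ, Measure.restrict_univ] at this
  rw [this]
  exact ENNReal.one_lt_top

/-- The standard deviation `σ` normal distribution on `ι → ℝ` with mean `m`. -/
noncomputable abbrev isoNormal (m : ι → ℝ) (σ : ℝ) : Measure (ι → ℝ) :=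
  Measure.pi fun i => gaussianReal (m i) (σ ^ 2).toNNReal

lemma isoNormal_zero_eq_withDensity {σ τ : ℝ} (hσ : 0 < σ) (hτ : 0 < τ) (m : ι → ℝ) :
    isoNormal (0 : ι → ℝ) σ = (isoNormal m τ).withDensity
      fun θ => ENNReal.ofReal (Real.exp (-∑ i, gaussianLogRatio σ τ (m i) (θ i))) := by
  have h := fun i => gaussianReal_eq_withDensity hσ hτ (m i)
  have : ∀ i, IsProbabilityMeasure ((gaussianReal (m i) (τ ^ 2).toNNReal).withDensity
      fun t => ENNReal.ofReal (Real.exp (-gaussianLogRatio σ τ (m i) t))) := fun i => by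
    rw [← h i]; infer_instance
  have h2 := pi_withDensity_ofReal (fun i => gaussianReal (m i) (τ ^ 2).toNNReal)
    (fun i t => Real.exp (-gaussianLogRatio σ τ (m i) t)) (fun i t => (Real.exp_pos _).le)
    (fun i => integrable_exp_neg_gaussianLogRatio hσ hτ (m i))
  simp only [← Real.exp_sum, Finset.sum_neg_distrib] at h2
  rw [isoNormal, isoNormal, ← h2]
  congr 1
  ext1 i
  exact h i

end Density

/-! ### Gaussian moments and expected losses -/

section Moments

variable {ι : Type*} [Fintype ι]

lemma memLp_two_gaussianReal_id (m τ : ℝ) :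
    MemLp (fun t => t) 2 (gaussianReal m (τ ^ 2).toNNReal) :=
  memLp_id_gaussianReal 2

lemma integral_sq_sub_gaussianReal (m τ : ℝ) :
    ∫ t, (t - m) ^ 2 ∂(gaussianReal m (τ ^ 2).toNNReal) = τ ^ 2 := by
  have h := variance_fun_id_gaussianReal (μ := m) (v := (τ ^ 2).toNNReal)
  rw [variance_eq_integral (by fun_prop), integral_id_gaussianReal,
    Real.coe_toNNReal _ (sq_nonneg τ)] at h
  exact h

lemma integral_sq_gaussianReal (m τ : ℝ) :
    ∫ t, t ^ 2 ∂(gaussianReal m (τ ^ 2).toNNReal) = m ^ 2 + τ ^ 2 := by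
  have h := variance_fun_id_gaussianReal (μ := m) (v := (τ ^ 2).toNNReal)
  rw [variance_eq_sub (memLp_two_gaussianReal_id m τ), integral_id_gaussianReal,
    Real.coe_toNNReal _ (sq_nonneg τ)] at h
  simp only [Pi.pow_apply] at h
  linarith

lemma integrable_sq_sub_gaussianReal (m τ a : ℝ) :
    Integrable (fun t => (t - a) ^ 2) (gaussianReal m (τ ^ 2).toNNReal) :=
  ((memLp_two_gaussianReal_id m τ).sub (memLp_const a)).integrable_sq

lemma integrable_gaussianLogRatio (σ τ m : ℝ) :
    Integrable (gaussianLogRatio σ τ m) (gaussianReal m (τ ^ 2).toNNReal) := by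
  have h1 := integrable_sq_sub_gaussianReal m τ 0
  simp only [sub_zero] at h1
  exact ((h1.div_const _).sub ((integrable_sq_sub_gaussianReal m τ m).div_const _)).add
    (integrable_const _)

/-- This is the Kullback–Leibler divergence of `N(m, τ²)` from `N(0, σ²)`. -/
lemma integral_gaussianLogRatio {σ τ : ℝ} (hτ : 0 < τ) (m : ℝ) :
    ∫ t, gaussianLogRatio σ τ m t ∂(gaussianReal m (τ ^ 2).toNNReal)
      = (m ^ 2 + τ ^ 2) / (2 * σ ^ 2) - 1 / 2 + Real.log (σ / τ) := by
  have h1 := integrable_sq_sub_gaussianReal m τ 0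
  simp only [sub_zero] at h1
  have h2 := integrable_sq_sub_gaussianReal m τ m
  have h3 : Integrable (fun t => t ^ 2 / (2 * σ ^ 2) - (t - m) ^ 2 / (2 * τ ^ 2))
      (gaussianReal m (τ ^ 2).toNNReal) := (h1.div_const _).sub (h2.div_const _)
  unfold gaussianLogRatio
  rw [integral_add h3 (integrable_const _),
    integral_sub (h1.div_const _) (h2.div_const _), integral_div, integral_div,
    integral_sq_gaussianReal, integral_sq_sub_gaussianReal]
  simp only [integral_const, probReal_univ, one_smul]
  field_simp

lemma memLp_dotProduct_isoNormal (a m : ι → ℝ) (τ : ℝ) :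
    MemLp (fun θ => a ⬝ᵥ θ) 2 (isoNormal m τ) := by
  unfold dotProduct
  refine memLp_finsetSum _ fun i _ => ?_
  exact ((memLp_two_gaussianReal_id (m i) τ).const_mul (a i)).comp_measurePreserving
    (measurePreserving_eval _ i)

lemma integral_dotProduct_isoNormal (a m : ι → ℝ) (τ : ℝ) :
    ∫ θ, a ⬝ᵥ θ ∂(isoNormal m τ) = a ⬝ᵥ m := by
  unfold dotProduct
  rw [integral_finsetSum]
  · refine Finset.sum_congr rfl fun i _ => ?_
    rw [integral_const_mul,
      integral_comp_eval (μ := fun i => gaussianReal (m i) (τ ^ 2).toNNReal) (f := fun t : ℝ => t)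
        (by fun_prop), integral_id_gaussianReal]
  · intro i _
    exact (((memLp_two_gaussianReal_id (m i) τ).const_mul (a i)).comp_measurePreserving
      (measurePreserving_eval _ i)).integrable (by norm_num)

lemma integral_sq_dotProduct_sub_isoNormal (a m : ι → ℝ) (τ : ℝ) :
    ∫ θ, (a ⬝ᵥ θ - a ⬝ᵥ m) ^ 2 ∂(isoNormal m τ) = τ ^ 2 * (a ⬝ᵥ a) := by
  have h := variance_sum_pi (μ := fun i => gaussianReal (m i) (τ ^ 2).toNNReal)
    (X := fun i t => a i * t) (fun i => (memLp_two_gaussianReal_id (m i) τ).const_mul (a i))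
  have h1 : (∑ i, fun ω : ι → ℝ => a i * ω i) = fun θ => a ⬝ᵥ θ := by
    ext θ; simp [dotProduct]
  rw [h1, variance_eq_integral (memLp_dotProduct_isoNormal a m τ).aestronglyMeasurable.aemeasurable,
    integral_dotProduct_isoNormal] at h
  rw [h, dotProduct, Finset.mul_sum]
  refine Finset.sum_congr rfl fun i _ => ?_
  rw [variance_const_mul (a i) (fun t => t), variance_fun_id_gaussianReal,
    Real.coe_toNNReal _ (sq_nonneg τ)]
  ring

lemma integrable_exp_dotProduct_isoNormal (a m : ι → ℝ) (τ : ℝ) :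
    Integrable (fun θ => Real.exp (a ⬝ᵥ θ)) (isoNormal m τ) := by
  simp only [dotProduct, Real.exp_sum]
  exact Integrable.fintype_prod (f := fun i t => Real.exp (a i * t))
    fun i => integrable_exp_mul_gaussianReal (a i)

/-- The tangent at 0 bounds `g` from below and the quadratic at 0 bounds it from above; both have
finite Gaussian expectation. -/
lemma integrable_comp_dotProduct_isoNormal {g : ℝ → ℝ} {c : ℝ} (hg : ContDiff ℝ 2 g)
    (hconv : ConvexOn ℝ Set.univ g) (hc : ∀ z, |iteratedDeriv 2 g z| ≤ c) (φ m : ι → ℝ) (τ : ℝ) :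
    Integrable (fun θ => g (φ ⬝ᵥ θ)) (isoNormal m τ) := by
  have hL := memLp_dotProduct_isoNormal φ m τ
  have h1 : Integrable (fun θ => |g 0| + |deriv g 0| * |φ ⬝ᵥ θ| + |c / 2| * (φ ⬝ᵥ θ) ^ 2)
      (isoNormal m τ) :=
    ((integrable_const _).add ((hL.integrable (by norm_num)).abs.const_mul _)).add
      (hL.integrable_sq.const_mul _)
  refine h1.mono' ((hg.continuous.comp
    (continuous_dotProduct_left φ)).aestronglyMeasurable) (ae_of_all _ fun θ => ?_)
  have e1 := convexOn_tangent_le hconv (hg.differentiable (by norm_num) 0) (φ ⬝ᵥ θ)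
  have e2 := le_quadratic_of_deriv_two_le hg hc 0 (φ ⬝ᵥ θ)
  simp only [sub_zero] at e1 e2
  have a1 := abs_le.1 (abs_mul (deriv g 0) (φ ⬝ᵥ θ)).le
  have a2 := neg_abs_le (g 0)
  have a3 := le_abs_self (g 0)
  have a4 : c / 2 * (φ ⬝ᵥ θ) ^ 2 ≤ |c / 2| * (φ ⬝ᵥ θ) ^ 2 := by gcongr; exact le_abs_self _
  have a5 : 0 ≤ |c / 2| * (φ ⬝ᵥ θ) ^ 2 := by positivity
  rw [Real.norm_eq_abs, abs_le]
  constructor <;> linarith [a1.1, a1.2]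

/-- In the quadratic bound centred at the mean, the linear term integrates to zero. -/
lemma integral_comp_dotProduct_isoNormal_le {g : ℝ → ℝ} {c : ℝ} (hg : ContDiff ℝ 2 g)
    (hconv : ConvexOn ℝ Set.univ g) (hc : ∀ z, |iteratedDeriv 2 g z| ≤ c) (φ m : ι → ℝ) (τ : ℝ) :
    ∫ θ, g (φ ⬝ᵥ θ) ∂(isoNormal m τ) ≤ g (φ ⬝ᵥ m) + c * τ ^ 2 * (φ ⬝ᵥ φ) / 2 := by
  have hL := memLp_dotProduct_isoNormal φ m τ
  have hL1 : Integrable (fun θ => deriv g (φ ⬝ᵥ m) * (φ ⬝ᵥ θ - φ ⬝ᵥ m)) (isoNormal m τ) :=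
    ((hL.integrable (by norm_num)).sub (integrable_const _)).const_mul _
  have hL2 : Integrable (fun θ => c / 2 * (φ ⬝ᵥ θ - φ ⬝ᵥ m) ^ 2) (isoNormal m τ) :=
    (hL.sub (memLp_const _)).integrable_sq.const_mul _
  have hL3 : Integrable (fun θ => g (φ ⬝ᵥ m) + deriv g (φ ⬝ᵥ m) * (φ ⬝ᵥ θ - φ ⬝ᵥ m))
      (isoNormal m τ) := (integrable_const _).add hL1
  calc _ ≤ ∫ θ, g (φ ⬝ᵥ m) + deriv g (φ ⬝ᵥ m) * (φ ⬝ᵥ θ - φ ⬝ᵥ m)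
        + c / 2 * (φ ⬝ᵥ θ - φ ⬝ᵥ m) ^ 2 ∂(isoNormal m τ) :=
        integral_mono (integrable_comp_dotProduct_isoNormal hg hconv hc φ m τ)
          (hL3.add hL2)
          fun θ => le_quadratic_of_deriv_two_le hg hc _ _
    _ = _ := by
        rw [integral_add hL3 hL2, integral_add (integrable_const _) hL1,
          integral_const_mul, integral_const_mul, integral_sq_dotProduct_sub_isoNormal,
          integral_sub (hL.integrable (by norm_num)) (integrable_const _),
          integral_dotProduct_isoNormal]
        simp only [integral_const, probReal_univ, one_smul]
        ring

end Moments

section Jensen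

lemma neg_log_integral_exp_neg_le {Ω : Type*} [MeasurableSpace Ω] {μ : Measure Ω}
    [IsProbabilityMeasure μ] {h : Ω → ℝ} (hi : Integrable h μ)
    (he : Integrable (fun ω => Real.exp (-h ω)) μ) :
    -Real.log (∫ ω, Real.exp (-h ω) ∂μ) ≤ ∫ ω, h ω ∂μ := by
  have := convexOn_exp.map_integral_le Real.continuous_exp.continuousOn isClosed_univ
    (ae_of_all _ fun _ => Set.mem_univ _) hi.neg he
  simp only [Pi.neg_apply, integral_neg] at this
  have h2 := Real.log_le_log (Real.exp_pos _) this
  rw [Real.log_exp] at h2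
  linarith

end Jensen

/-! ### Variational bound for the Bayesian mixture -/

section KakadeNg

variable {ι : Type*} [Fintype ι] {g : ℕ → ℝ → ℝ} {φ : ℕ → ι → ℝ} {c : ℝ} {T : ℕ}

/-- The losses need not be bounded below. Convexity puts each above its tangent at 0, so the
integrand is dominated by the exponential of an affine functional. -/
lemma integrable_exp_neg_sum (hg : ∀ t < T, ContDiff ℝ 2 (g t))
    (hconv : ∀ t < T, ConvexOn ℝ Set.univ (g t)) (m : ι → ℝ) (σ : ℝ) :
    Integrable (fun θ => Real.exp (-∑ t ∈ Finset.range T, g t (φ t ⬝ᵥ θ))) (isoNormal m σ) := by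
  set a : ι → ℝ := -∑ t ∈ Finset.range T, deriv (g t) 0 • φ t with ha
  have h1 := (integrable_exp_dotProduct_isoNormal a m σ).const_mul
    (Real.exp (-∑ t ∈ Finset.range T, g t 0))
  refine h1.mono' ?_ (ae_of_all _ fun θ => ?_)
  · refine Continuous.aestronglyMeasurable (Real.continuous_exp.comp (continuous_neg.comp ?_))
    exact continuous_finsetSum _ fun t ht =>
      (hg t (Finset.mem_range.1 ht)).continuous.comp (continuous_dotProduct_left _)
  · rw [Real.norm_eq_abs, Real.abs_exp, ← Real.exp_add, Real.exp_le_exp, ha, neg_dotProduct,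
      ← neg_add, neg_le_neg_iff, sum_dotProduct, ← Finset.sum_add_distrib]
    refine Finset.sum_le_sum fun t ht => ?_
    have ht := Finset.mem_range.1 ht
    have := convexOn_tangent_le (hconv t ht) ((hg t ht).differentiable (by norm_num) 0) (φ t ⬝ᵥ θ)
    simpa [smul_dotProduct] using this

/-- The Bayesian mixture loss of a Gaussian prior on the weights of a generalized linear model is
at most the loss of any fixed weight vector up to a logarithmic term. -/
theorem neg_log_integral_exp_neg_sum_le [Nonempty ι] (hg : ∀ t < T, ContDiff ℝ 2 (g t))
    (hconv : ∀ t < T, ConvexOn ℝ Set.univ (g t))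
    (hc : ∀ t < T, ∀ z, |iteratedDeriv 2 (g t) z| ≤ c) (hφ : ∀ t < T, φ t ⬝ᵥ φ t = 1)
    {σ : ℝ} (hσ : 0 < σ) (m : ι → ℝ) :
    -Real.log (∫ θ, Real.exp (-∑ t ∈ Finset.range T, g t (φ t ⬝ᵥ θ)) ∂(isoNormal (0 : ι → ℝ) σ))
      ≤ ∑ t ∈ Finset.range T, g t (φ t ⬝ᵥ m) + m ⬝ᵥ m / (2 * σ ^ 2)
        + Fintype.card ι / 2 * Real.log (1 + T * c * σ ^ 2 / Fintype.card ι) := by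
  set n : ℝ := (Fintype.card ι : ℝ) with hn
  have hn0 : 0 < n := by rw [hn]; exact_mod_cast Fintype.card_pos
  -- Only a time `t < T` forces `c ≥ 0`; for `T = 0` the product vanishes.
  have hTc : 0 ≤ T * c := by
    rcases Nat.eq_zero_or_pos T with rfl | hT
    · simp
    · exact mul_nonneg (Nat.cast_nonneg T) ((abs_nonneg _).trans (hc 0 hT 0))
  set A : ℝ := 1 + T * c * σ ^ 2 / n with hA
  have hA0 : 0 < A := by positivity
  -- This variance makes the curvature cost `T c τ² / 2` cancel the non-logarithmic, `m`-free part
  -- of the divergence (`b4`).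
  set τ : ℝ := σ / √A with hτd
  have hτ : 0 < τ := by positivity
  have hτ2 : τ ^ 2 = σ ^ 2 / A := by rw [hτd, div_pow, Real.sq_sqrt hA0.le]
  set G : (ι → ℝ) → ℝ := fun θ => ∑ t ∈ Finset.range T, g t (φ t ⬝ᵥ θ) with hG
  set R : (ι → ℝ) → ℝ := fun θ => ∑ i, gaussianLogRatio σ τ (m i) (θ i) with hR
  have hdens := isoNormal_zero_eq_withDensity hσ hτ m
  have hRc : Continuous R := continuous_finsetSum _ fun i _ =>
    (continuous_gaussianLogRatio σ τ (m i)).comp (continuous_apply i)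
  have hmeas : Measurable fun θ => ENNReal.ofReal (Real.exp (-R θ)) :=
    hRc.neg.rexp.measurable.ennreal_ofReal
  have hexp : Integrable (fun θ => Real.exp (-(G θ + R θ))) (isoNormal m τ) := by
    have h1 := integrable_exp_neg_sum (φ := φ) hg hconv 0 σ
    rw [hdens, integrable_withDensity_iff_integrable_smul' hmeas
      (ae_of_all _ fun _ => ENNReal.ofReal_lt_top)] at h1
    refine h1.congr (ae_of_all _ fun θ => ?_)
    simp only
    rw [ENNReal.toReal_ofReal (Real.exp_pos _).le, smul_eq_mul, ← Real.exp_add]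
    congr 1; ring
  have hZ : ∫ θ, Real.exp (-G θ) ∂(isoNormal (0 : ι → ℝ) σ)
      = ∫ θ, Real.exp (-(G θ + R θ)) ∂(isoNormal m τ) := by
    rw [hdens, integral_withDensity_eq_integral_toReal_smul hmeas
      (ae_of_all _ fun _ => ENNReal.ofReal_lt_top)]
    refine integral_congr_ae (ae_of_all _ fun θ => ?_)
    simp only
    rw [ENNReal.toReal_ofReal (Real.exp_pos _).le, smul_eq_mul, ← Real.exp_add]
    congr 1; ring
  have hGi : Integrable G (isoNormal m τ) := integrable_finsetSum _ fun t ht => by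
    have ht := Finset.mem_range.1 ht
    exact integrable_comp_dotProduct_isoNormal (hg t ht) (hconv t ht) (hc t ht) _ _ _
  have hRi' : ∀ i, Integrable (fun θ : ι → ℝ => gaussianLogRatio σ τ (m i) (θ i))
      (isoNormal m τ) := fun i =>
    integrable_comp_eval (μ := fun i => gaussianReal (m i) (τ ^ 2).toNNReal)
      (integrable_gaussianLogRatio σ τ (m i))
  have hRi : Integrable R (isoNormal m τ) := integrable_finsetSum _ fun i _ => hRi' i
  rw [hZ]
  refine (neg_log_integral_exp_neg_le (hGi.add hRi) hexp).trans ?_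
  simp only [Pi.add_apply]
  rw [integral_add hGi hRi]
  have b1 : ∫ θ, G θ ∂(isoNormal m τ)
      ≤ ∑ t ∈ Finset.range T, g t (φ t ⬝ᵥ m) + T * c * τ ^ 2 / 2 := by
    rw [hG, integral_finsetSum _ fun t ht => by
      have ht := Finset.mem_range.1 ht
      exact integrable_comp_dotProduct_isoNormal (hg t ht) (hconv t ht) (hc t ht) _ _ _]
    have : (T : ℝ) * c * τ ^ 2 / 2 = ∑ _t ∈ Finset.range T, c * τ ^ 2 / 2 := by
      simp; ring
    rw [this, ← Finset.sum_add_distrib]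
    refine Finset.sum_le_sum fun t ht => ?_
    have ht := Finset.mem_range.1 ht
    have := integral_comp_dotProduct_isoNormal_le (hg t ht) (hconv t ht) (hc t ht) (φ t) m τ
    rwa [hφ t ht, mul_one] at this
  have b2 : ∫ θ, R θ ∂(isoNormal m τ)
      = m ⬝ᵥ m / (2 * σ ^ 2) + n * (τ ^ 2 / (2 * σ ^ 2) - 1 / 2 + Real.log (σ / τ)) := by
    rw [hR, integral_finsetSum _ fun i _ => hRi' i]
    have : ∀ i, ∫ θ, gaussianLogRatio σ τ (m i) (θ i) ∂(isoNormal m τ)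
        = m i * m i / (2 * σ ^ 2) + (τ ^ 2 / (2 * σ ^ 2) - 1 / 2 + Real.log (σ / τ)) := fun i => by
      rw [integral_comp_eval (μ := fun i => gaussianReal (m i) (τ ^ 2).toNNReal)
        (f := gaussianLogRatio σ τ (m i))
        (continuous_gaussianLogRatio σ τ (m i)).aestronglyMeasurable, integral_gaussianLogRatio hτ]
      ring
    simp only [this, Finset.sum_add_distrib, dotProduct, Finset.sum_div]
    simp [hn]
    ring
  have b3 : Real.log (σ / τ) = Real.log A / 2 := by
    rw [hτd, div_div_cancel₀ hσ.ne', Real.log_sqrt hA0.le]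
  have b4 : T * c * τ ^ 2 / 2 + n * (τ ^ 2 / (2 * σ ^ 2) - 1 / 2) = 0 := by
    have : T * c * σ ^ 2 = n * (A - 1) := by rw [hA]; field_simp; ring
    rw [hτ2]
    field_simp
    linear_combination this
  rw [b2, b3]
  linear_combination b1 + b4

end KakadeNg

/-! ### Telescoping the online losses -/

section BayesLoss

variable {d D : ℕ} {ℓ : ℝ → ℝ → ℝ} {σθ : ℝ} {v : Fin D → Pt d} {x : ℕ → Pt d} {y : ℕ → ℝ}

instance (D : ℕ) (σθ : ℝ) : IsProbabilityMeasure (prior D σθ) := by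
  unfold prior; infer_instance

/-- Successive tilts compose to one tilt by the summed exponent; each composition needs the earlier
weight to be integrable. -/
lemma posterior_eq_tilted {t : ℕ}
    (h : ∀ r < t, Integrable (fun θ => Real.exp
      (-∑ s ∈ Finset.range r, ℓ (feature v (x s) ⬝ᵥ θ) (y s))) (prior D σθ)) :
    posterior ℓ σθ v x y t
      = (prior D σθ).tilted fun θ => -∑ s ∈ Finset.range t, ℓ (feature v (x s) ⬝ᵥ θ) (y s) := by
  induction t with
  | zero => simp [posterior]
  | succ t ih =>
    rw [posterior, ih fun r hr => h r (hr.trans t.lt_succ_self), tilted_tilted (h t t.lt_succ_self)]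
    congr 1
    ext θ
    rw [Pi.add_apply, Finset.sum_range_succ, neg_add]

/-- Each one-step predictive density is a ratio of consecutive marginal likelihoods, so the product
telescopes. -/
lemma sum_bayesLoss_eq {T : ℕ}
    (h : ∀ r ≤ T, Integrable (fun θ => Real.exp
      (-∑ s ∈ Finset.range r, ℓ (feature v (x s) ⬝ᵥ θ) (y s))) (prior D σθ)) :
    ∑ t ∈ Finset.range T, bayesLoss ℓ σθ v x y t
      = -Real.log (∫ θ, Real.exp
          (-∑ s ∈ Finset.range T, ℓ (feature v (x s) ⬝ᵥ θ) (y s)) ∂(prior D σθ)) := by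
  induction T with
  | zero => simp
  | succ T ih =>
    rw [Finset.sum_range_succ, ih fun r hr => h r (hr.trans T.le_succ), bayesLoss,
      posterior_eq_tilted fun r hr => h r (hr.le.trans T.le_succ), integral_exp_tilted,
      ← Real.log_inv, ← Real.log_inv, ← Real.log_inv, inv_div, ← Real.log_mul]
    · congr 1
      have h1 := (integral_exp_pos (h T T.le_succ)).ne'
      rw [div_eq_mul_inv, inv_mul_cancel_left₀ h1]
      congr 2
      ext θ
      rw [Pi.add_apply, Finset.sum_range_succ, neg_add]
    · exact (inv_pos.2 (integral_exp_pos (h T T.le_succ))).ne'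
    · refine (div_pos (integral_exp_pos (h T T.le_succ)) ?_).ne'
      have := integral_exp_pos (h (T + 1) le_rfl)
      refine this.trans_eq (integral_congr_ae (ae_of_all _ fun θ => ?_))
      simp only [Pi.add_apply, Finset.sum_range_succ, neg_add]

/-- Regret of the online Bayesian random feature predictor against a fixed weight vector. -/
theorem sum_bayesLoss_le (hD : 1 ≤ D) {T : ℕ} {c : ℝ} (hσ : 0 < σθ)
    (hg : ∀ t < T, ContDiff ℝ 2 fun z => ℓ z (y t))
    (hconv : ∀ t < T, ConvexOn ℝ Set.univ fun z => ℓ z (y t))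
    (hc : ∀ t < T, ∀ z, |iteratedDeriv 2 (fun z => ℓ z (y t)) z| ≤ c) (m : Idx D → ℝ) :
    ∑ t ∈ Finset.range T, bayesLoss ℓ σθ v x y t
      ≤ ∑ t ∈ Finset.range T, ℓ (feature v (x t) ⬝ᵥ m) (y t) + m ⬝ᵥ m / (2 * σθ ^ 2)
        + D * Real.log (1 + T * c * σθ ^ 2 / (2 * D)) := by
  have : Nonempty (Idx D) := ⟨(⟨0, hD⟩, 0)⟩
  have hprior : prior D σθ = isoNormal (0 : Idx D → ℝ) σθ := rfl
  rw [sum_bayesLoss_eq fun r hr => by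
    rw [hprior]
    exact integrable_exp_neg_sum (g := fun t z => ℓ z (y t)) (φ := fun t => feature v (x t))
      (fun t ht => hg t (ht.trans_le hr)) (fun t ht => hconv t (ht.trans_le hr)) 0 σθ, hprior]
  have := neg_log_integral_exp_neg_sum_le (g := fun t z => ℓ z (y t))
    (φ := fun t => feature v (x t)) hg hconv hc (fun t _ => feature_dotProduct_self hD v (x t)) hσ m
  refine this.trans_eq ?_
  have hcard : (Fintype.card (Idx D) : ℝ) = 2 * D := by simp [Idx, mul_comm]
  rw [hcard, mul_div_cancel_left₀ _ (two_ne_zero' ℝ)]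

end BayesLoss

/-! ### The comparator weight vector -/

section Comparator

variable {d D : ℕ} {σθ : ℝ} {v : Fin D → Pt d} {x : ℕ → Pt d} {α : ℕ → ℝ} {T : ℕ} {C : ℝ}

lemma feature_dotProduct_rfWeight (w : Idx D → ℝ) :
    w ⬝ᵥ rfWeight σθ v x α T
      = ∑ s ∈ Finset.range T, α s * (σθ ^ 2 * (w ⬝ᵥ feature v (x s))) := by
  rw [rfWeight, dotProduct_smul, dotProduct_sum, Finset.smul_sum]
  refine Finset.sum_congr rfl fun s _ => ?_
  rw [dotProduct_smul, smul_eq_mul, smul_eq_mul]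
  ring

/-- Hölder's inequality for `ℓ¹` and `ℓ^∞`. It is used with `δ = 1` for predictions, `δ = C` for the
norm of `θ^*` and `δ = ε` for the kernel error. -/
lemma abs_expansion_le {k : ℕ → ℝ} {δ : ℝ} (hδ : 0 ≤ δ) (hk : ∀ s < T, |k s| ≤ δ)
    (hα : ∑ s ∈ Finset.range T, σθ ^ 2 * |α s| ≤ C) :
    |∑ s ∈ Finset.range T, α s * (σθ ^ 2 * k s)| ≤ C * δ := by
  refine (Finset.abs_sum_le_sum_abs _ _).trans (le_trans (Finset.sum_le_sum fun s hs => ?_)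
    ((Finset.sum_mul _ _ δ).symm.le.trans (mul_le_mul_of_nonneg_right hα hδ)))
  rw [abs_mul, abs_mul, abs_of_nonneg (sq_nonneg σθ), ← mul_assoc, mul_comm |α s|]
  exact mul_le_mul_of_nonneg_left (hk s (Finset.mem_range.1 hs)) (by positivity)

lemma rfWeight_dotProduct_self_le (hα : ∑ s ∈ Finset.range T, σθ ^ 2 * |α s| ≤ C) :
    rfWeight σθ v x α T ⬝ᵥ rfWeight σθ v x α T ≤ C ^ 2 := by
  have hC : 0 ≤ C := (Finset.sum_nonneg fun s _ => by positivity).trans hα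
  rw [feature_dotProduct_rfWeight, sq C]
  refine (le_abs_self _).trans (abs_expansion_le hC (fun s _ => ?_) hα)
  rw [dotProduct_comm, feature_dotProduct_rfWeight]
  exact (abs_expansion_le zero_le_one (fun r _ => abs_feature_dotProduct_le_one _ _ _) hα).trans_eq
    (mul_one C)

end Comparator

lemma sub_le_of_abs_deriv_le {g : ℝ → ℝ} {C L : ℝ} (hg : Differentiable ℝ g)
    (hL : ∀ z, |z| ≤ C → |deriv g z| ≤ L) {a b : ℝ} (ha : |a| ≤ C) (hb : |b| ≤ C) :
    g a - g b ≤ L * |a - b| := by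
  have := (convex_Icc (-C) C).norm_image_sub_le_of_norm_deriv_le (f := g) (C := L)
    (fun z _ => hg z) (fun z hz => hL z (abs_le.2 hz)) (abs_le.1 hb) (abs_le.1 ha)
  exact (le_abs_self _).trans this

/-! ### Covering numbers of balls -/

section Covering

variable {E : Type*} [NormedAddCommGroup E] [NormedSpace ℝ E] [FiniteDimensional ℝ E]

open Metric Module in
-- Volume comparison: the balls of radius `r / 2` about the points are disjoint and lie in the ball
-- of radius `δ + r / 2 ≤ 3 δ / 2`.
lemma card_le_of_separated_closedBall {δ r : ℝ} (hr : 0 < r) (hrδ : r ≤ δ) (s : Finset E)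
    (hs : ∀ c ∈ s, ‖c‖ ≤ δ) (h : ∀ c ∈ s, ∀ c' ∈ s, c ≠ c' → r ≤ ‖c - c'‖) :
    (s.card : ℝ) ≤ (3 * δ / r) ^ finrank ℝ E := by
  borelize E
  let μ : Measure E := Measure.addHaar
  have hr2 : 0 < r / 2 := by positivity
  have hδ2 : 0 < 3 * δ / 2 := by linarith
  have hdisj : Set.PairwiseDisjoint (s : Set E) fun c => ball (c : E) (r / 2) := by
    rintro c hc c' hc' hcc
    refine ball_disjoint_ball ?_
    rw [dist_eq_norm]
    linarith [h c hc c' hc' hcc]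
  have hsub : (⋃ c ∈ s, ball (c : E) (r / 2)) ⊆ ball (0 : E) (3 * δ / 2) := by
    refine Set.iUnion₂_subset fun c hc => ball_subset_ball' ?_
    rw [dist_zero_right]
    linarith [hs c hc]
  have I : (s.card : ENNReal) * ENNReal.ofReal ((r / 2) ^ finrank ℝ E) * μ (ball 0 1) ≤
      ENNReal.ofReal ((3 * δ / 2) ^ finrank ℝ E) * μ (ball 0 1) := by
    rw [← μ.addHaar_ball_of_pos 0 hδ2]
    refine le_trans (le_of_eq ?_) (measure_mono hsub)
    rw [measure_biUnion_finset hdisj fun c _ => measurableSet_ball]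
    simp only [μ.addHaar_ball_of_pos _ hr2, Finset.sum_const, nsmul_eq_mul, mul_assoc]
  have J : (s.card : ENNReal) * ENNReal.ofReal ((r / 2) ^ finrank ℝ E)
      ≤ ENNReal.ofReal ((3 * δ / 2) ^ finrank ℝ E) :=
    (ENNReal.mul_le_mul_iff_left (measure_ball_pos _ _ zero_lt_one).ne' measure_ball_lt_top.ne).1 I
  have K := ENNReal.toReal_le_of_le_ofReal (by positivity) J
  rw [ENNReal.toReal_mul, ENNReal.toReal_natCast, ENNReal.toReal_ofReal (by positivity)] at K
  have e : 3 * δ / r = (3 * δ / 2) / (r / 2) := by field_simp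
  rwa [e, div_pow, le_div_iff₀ (by positivity)]

open Metric Module in
/-- A ball of radius `δ` in a `d`-dimensional space is covered by `(3 δ / r) ^ d` balls of
radius `r ≤ δ`. -/
lemma exists_finset_cover_closedBall {δ r : ℝ} (hr : 0 < r) (hrδ : r ≤ δ) :
    ∃ s : Finset E, (∀ x : E, ‖x‖ ≤ δ → ∃ c ∈ s, ‖x - c‖ ≤ r) ∧
      (s.card : ℝ) ≤ (3 * δ / r) ^ finrank ℝ E := by
  set A : Set E := closedBall 0 δ with hA
  set ε : NNReal := ⟨r, hr.le⟩ with hε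
  have hε0 : ε / 2 ≠ 0 := by
    have : ε ≠ 0 := fun h => hr.ne' (congrArg NNReal.toReal h)
    simpa using this
  -- Compactness gives a finite cover at scale `ε / 2`, which bounds the packing number at scale
  -- `ε`. A maximal separated set is then a finite cover.
  have hfin : packingNumber ε A ≠ ⊤ := by
    have := FiniteDimensional.proper_real E
    obtain ⟨N, -, hN, hcov⟩ := exists_finite_isCover_of_isCompact hε0 (isCompact_closedBall (0 : E) δ)
    have h1 := packingNumber_two_mul_le_externalCoveringNumber (ε / 2) A
    rw [mul_div_cancel₀ _ (two_ne_zero' NNReal)] at h1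
    exact ((h1.trans (IsCover.externalCoveringNumber_le_encard hcov)).trans_lt
      hN.encard_lt_top).ne
  have hMfin : (maximalSeparatedSet ε A).Finite := by
    rw [← Set.encard_ne_top_iff, encard_maximalSeparatedSet hfin]
    exact hfin
  refine ⟨hMfin.toFinset, fun x hx => ?_, ?_⟩
  · obtain ⟨c, hc, hxc⟩ := isCover_maximalSeparatedSet hfin (by simpa [hA] using hx : x ∈ A)
    refine ⟨c, by simpa using hc, ?_⟩
    have hxc' : edist x c ≤ ε := hxc
    rw [edist_le_coe, ← NNReal.coe_le_coe, coe_nndist, dist_eq_norm] at hxc'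
    exact hxc'
  · refine card_le_of_separated_closedBall hr hrδ _ (fun c hc => ?_) fun c hc c' hc' hcc => ?_
    · have := maximalSeparatedSet_subset (by simpa using hc : c ∈ maximalSeparatedSet ε A)
      simpa [hA] using this
    · have h1 : (ε : ENNReal) < edist c c' :=
        isSeparated_maximalSeparatedSet (by simpa using hc) (by simpa using hc') hcc
      rw [edist_nndist, ENNReal.coe_lt_coe, ← NNReal.coe_lt_coe, coe_nndist, dist_eq_norm] at h1
      exact h1.le

end Covering

/-! ### Kernel deviation: concentration and covering -/

section RandomFeatures

variable {d D : ℕ} {ρ : Measure (Pt d)} [IsProbabilityMeasure ρ]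

/-- The deviation `D⁻¹ ∑ᵢ cos (vᵢᵀt) - E cos (vᵀt)` of the empirical kernel from the kernel. -/
noncomputable def kernelDev (ρ : Measure (Pt d)) (v : Fin D → Pt d) (t : Pt d) : ℝ :=
  (∑ i, Real.cos ⟪v i, t⟫) / D - ∫ w, Real.cos ⟪w, t⟫ ∂ρ

instance (ρ : Measure (Pt d)) [IsProbabilityMeasure ρ] : IsProbabilityMeasure (freqLaw ρ D) := by
  unfold freqLaw; infer_instance

lemma integrable_cos_inner (t : Pt d) : Integrable (fun w : Pt d => Real.cos ⟪w, t⟫) ρ :=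
  Integrable.of_bound (C := 1) (by fun_prop) (ae_of_all _ fun w => Real.abs_cos_le_one _)

lemma integral_freqLaw_average (hD : 1 ≤ D) {h : Pt d → ℝ} (hh : Integrable h ρ) :
    Integrable (fun v : Fin D → Pt d => (∑ i, h (v i)) / D) (freqLaw ρ D) ∧
    ∫ v, (∑ i, h (v i)) / D ∂(freqLaw ρ D) = ∫ w, h w ∂ρ := by
  have hi : ∀ i, Integrable (fun v : Fin D → Pt d => h (v i)) (freqLaw ρ D) := fun i =>
    integrable_comp_eval (μ := fun _ : Fin D => ρ) hh
  refine ⟨(integrable_finsetSum _ fun i _ => hi i).div_const _, ?_⟩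
  rw [integral_div, integral_finsetSum _ fun i _ => hi i]
  have : ∀ i, ∫ v, h (v i) ∂(freqLaw ρ D) = ∫ w, h w ∂ρ := fun i =>
    integral_comp_eval (μ := fun _ : Fin D => ρ) hh.aestronglyMeasurable
  simp only [this, Finset.sum_const, Finset.card_univ, Fintype.card_fin, nsmul_eq_mul]
  have : (D : ℝ) ≠ 0 := by positivity
  field_simp

lemma abs_kernelDev_le_two (hD : 1 ≤ D) (v : Fin D → Pt d) (t : Pt d) :
    |kernelDev ρ v t| ≤ 2 := by
  have hD0 : (0 : ℝ) < D := by positivity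
  have h1 : |(∑ i, Real.cos ⟪v i, t⟫) / D| ≤ 1 := by
    rw [abs_div, Nat.abs_cast, div_le_one hD0]
    refine (Finset.abs_sum_le_sum_abs _ _).trans
      ((Finset.sum_le_sum fun i _ => Real.abs_cos_le_one _).trans (by simp))
  have h2 : |∫ w, Real.cos ⟪w, t⟫ ∂ρ| ≤ 1 := by
    rw [← charFun_re]
    exact (Complex.abs_re_le_norm _).trans (norm_charFun_le_one _)
  rw [kernelDev]
  exact (abs_sub _ _).trans (by linarith)

/-- Hoeffding: cosines lie in `[-1, 1]`, so the variance proxy is 1. The sign `s` in `key` treats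
both tails at once. -/
lemma measureReal_abs_kernelDev_ge_le (hD : 1 ≤ D) (t : Pt d) {η : ℝ} (hη : 0 ≤ η) :
    (freqLaw ρ D).real {v | η ≤ |kernelDev ρ v t|} ≤ 2 * Real.exp (-(D * η ^ 2) / 2) := by
  have hD0 : (0 : ℝ) < D := by positivity
  have key : ∀ s : ℝ, |s| = 1 → (freqLaw ρ D).real {v | η ≤ s * kernelDev ρ v t}
      ≤ Real.exp (-(D * η ^ 2) / 2) := by
    intro s hs
    set X : Pt d → ℝ := fun w => s * Real.cos ⟪w, t⟫ with hX
    have hXm : Measurable X := by rw [hX]; fun_prop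
    have hXb : ∀ w, X w ∈ Set.Icc (-1 : ℝ) 1 := fun w => by
      have : |X w| ≤ 1 := by
        rw [hX, abs_mul, hs, one_mul]
        exact Real.abs_cos_le_one _
      exact abs_le.1 this
    have hsub1 := hasSubgaussianMGF_of_mem_Icc (μ := ρ) hXm.aemeasurable
      (ae_of_all _ hXb)
    have hind : iIndepFun (fun (i : Fin D) (v : Fin D → Pt d) => X (v i) - ∫ w, X w ∂ρ)
        (freqLaw ρ D) :=
      iIndepFun_pi (μ := fun _ : Fin D => ρ) (X := fun _ w => X w - ∫ w, X w ∂ρ)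
        fun i => (hXm.sub_const _).aemeasurable
    have hsub : ∀ i ∈ (Finset.univ : Finset (Fin D)), HasSubgaussianMGF
        (fun v : Fin D → Pt d => X (v i) - ∫ w, X w ∂ρ) ((‖(1 : ℝ) - (-1)‖₊ / 2) ^ 2)
          (freqLaw ρ D) := by
      intro i _
      refine HasSubgaussianMGF.of_map (Y := fun v : Fin D → Pt d => v i)
        (X := fun w => X w - ∫ w, X w ∂ρ) (measurable_pi_apply i).aemeasurable ?_
      have : (freqLaw ρ D).map (fun v => v i) = ρ :=
        (measurePreserving_eval (fun _ : Fin D => ρ) i).map_eq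
      rw [this]
      exact hsub1
    have h := HasSubgaussianMGF.measure_sum_ge_le_of_iIndepFun hind hsub
      (ε := D * η) (by positivity)
    have hc : ((‖(1 : ℝ) - (-1)‖₊ / 2) ^ 2 : NNReal) = 1 := by
      have : ‖(1 : ℝ) - (-1)‖₊ = 2 := by
        rw [← NNReal.coe_inj, coe_nnnorm]; norm_num
      rw [this]; simp
    have hexp : -(D * η) ^ 2 / (2 * ((∑ _i : Fin D,
        ((‖(1 : ℝ) - (-1)‖₊ / 2) ^ 2 : NNReal) : NNReal) : ℝ)) = -(D * η ^ 2) / 2 := by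
      rw [hc]
      simp
      field_simp
    rw [hexp] at h
    refine le_trans (measureReal_mono fun v hv => ?_) h
    simp only [Set.mem_ofPred_eq, Finset.sum_sub_distrib] at hv ⊢
    rw [hX, integral_const_mul, ← Finset.mul_sum]
    simp only [Finset.sum_const, Finset.card_univ, Fintype.card_fin, nsmul_eq_mul]
    rw [kernelDev] at hv
    have := mul_le_mul_of_nonneg_left hv hD0.le
    refine this.trans_eq ?_
    field_simp
  have hsub : {v : Fin D → Pt d | η ≤ |kernelDev ρ v t|}
      ⊆ {v | η ≤ 1 * kernelDev ρ v t} ∪ {v | η ≤ (-1) * kernelDev ρ v t} := by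
    intro v hv
    simp only [Set.mem_ofPred_eq, Set.mem_union, one_mul, neg_one_mul] at hv ⊢
    exact le_abs.1 hv
  calc _ ≤ _ := measureReal_mono hsub
    _ ≤ _ := measureReal_union_le _ _
    _ ≤ _ := by linarith [key 1 (by simp), key (-1) (by simp)]

/-- Cosine is 1-Lipschitz and Cauchy–Schwarz applies. The resulting Lipschitz constant is random and
is controlled later through second moments. -/
lemma abs_kernelDev_sub_le (hD : 1 ≤ D) (hρ : Integrable (fun w : Pt d => ‖w‖) ρ)
    (v : Fin D → Pt d) (t c : Pt d) :
    |kernelDev ρ v t - kernelDev ρ v c| ≤ ((∑ i, ‖v i‖) / D + ∫ w, ‖w‖ ∂ρ) * ‖t - c‖ := by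
  have hD0 : (0 : ℝ) < D := by positivity
  have hcos : ∀ w : Pt d, |Real.cos ⟪w, t⟫ - Real.cos ⟪w, c⟫| ≤ ‖w‖ * ‖t - c‖ := fun w => by
    refine (Real.abs_cos_sub_cos_le _ _).trans ?_
    rw [← inner_sub_right]
    exact abs_real_inner_le_norm _ _
  have h1 : |(∑ i, Real.cos ⟪v i, t⟫) / D - (∑ i, Real.cos ⟪v i, c⟫) / D|
      ≤ (∑ i, ‖v i‖) / D * ‖t - c‖ := by
    rw [← sub_div, ← Finset.sum_sub_distrib, abs_div, Nat.abs_cast, div_mul_eq_mul_div,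
      Finset.sum_mul]
    gcongr
    exact (Finset.abs_sum_le_sum_abs _ _).trans (Finset.sum_le_sum fun i _ => hcos _)
  have h2 : |∫ w, Real.cos ⟪w, t⟫ ∂ρ - ∫ w, Real.cos ⟪w, c⟫ ∂ρ| ≤ (∫ w, ‖w‖ ∂ρ) * ‖t - c‖ := by
    rw [← integral_sub (integrable_cos_inner t) (integrable_cos_inner c), ← integral_mul_const]
    exact norm_integral_le_of_norm_le (f := fun w : Pt d => Real.cos ⟪w, t⟫ - Real.cos ⟪w, c⟫)
      (hρ.mul_const ‖t - c‖) (ae_of_all _ hcos)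
  have e : kernelDev ρ v t - kernelDev ρ v c
      = ((∑ i, Real.cos ⟪v i, t⟫) / D - (∑ i, Real.cos ⟪v i, c⟫) / D)
        - (∫ w, Real.cos ⟪w, t⟫ ∂ρ - ∫ w, Real.cos ⟪w, c⟫ ∂ρ) := by
    rw [kernelDev, kernelDev]; ring
  rw [e, add_mul]
  exact (abs_sub _ _).trans (add_le_add h1 h2)

/-- Uniform deviation bound obtained from a cover of the ball by balls of radius `r`. -/
lemma measureReal_exists_kernelDev_gt_le_of_cover (hD : 1 ≤ D)
    (hmom : Integrable (fun w : Pt d => ‖w‖ ^ 2) ρ) {δ r ε : ℝ} (hr : 0 < r) (hrδ : r ≤ δ)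
    (hε : 0 < ε) :
    (freqLaw ρ D).real {v | ∃ t, ‖t‖ ≤ δ ∧ ε < |kernelDev ρ v t|}
      ≤ (3 * δ / r) ^ d * (2 * Real.exp (-(D * ε ^ 2) / 8))
        + 16 * (∫ w, ‖w‖ ^ 2 ∂ρ) * r ^ 2 / ε ^ 2 := by
  have hD0 : (0 : ℝ) < D := by positivity
  have hL : MemLp (fun w : Pt d => ‖w‖) 2 ρ :=
    (memLp_two_iff_integrable_sq (by fun_prop)).2 hmom
  have hL1 : Integrable (fun w : Pt d => ‖w‖) ρ := hL.integrable (by norm_num)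
  set m₂ : ℝ := ∫ w, ‖w‖ ^ 2 ∂ρ with hm₂
  set a : ℝ := ∫ w, ‖w‖ ∂ρ with ha
  have ha2 : a ^ 2 ≤ m₂ := by
    have h1 := variance_nonneg (fun w : Pt d => ‖w‖) ρ
    rw [variance_eq_sub hL] at h1
    simp only [Pi.pow_apply] at h1
    linarith
  obtain ⟨s, hs, hcard⟩ := exists_finset_cover_closedBall (E := Pt d) hr hrδ
  rw [finrank_euclideanSpace_fin] at hcard
  obtain ⟨hQi, hQ⟩ := integral_freqLaw_average hD hmom
  -- Outside the Hoeffding events, a large deviation needs Lipschitz constant at least `ε / (2 r)`.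
  -- Its square is at most the right-hand side here, whose mean `4 * m₂` feeds Markov's inequality.
  set B : Set (Fin D → Pt d) := {v | ε ^ 2 / (4 * r ^ 2)
    ≤ 2 * ((∑ i, ‖v i‖ ^ 2) / D) + 2 * m₂} with hB
  have hm₂0 : 0 ≤ m₂ := integral_nonneg fun w => sq_nonneg _
  have hBle : (freqLaw ρ D).real B ≤ 16 * m₂ * r ^ 2 / ε ^ 2 := by
    have h1 := mul_meas_ge_le_integral_of_nonneg
      (f := fun v : Fin D → Pt d => 2 * ((∑ i, ‖v i‖ ^ 2) / D) + 2 * m₂)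
      (μ := freqLaw ρ D) (ae_of_all _ fun v => by
        simp only [Pi.zero_apply]; positivity)
      ((hQi.const_mul 2).add (integrable_const _)) (ε ^ 2 / (4 * r ^ 2))
    rw [integral_add (hQi.const_mul 2) (integrable_const _), integral_const_mul, hQ] at h1
    simp only [integral_const, probReal_univ, one_smul] at h1
    rw [le_div_iff₀ (by positivity)]
    have h2 : ε ^ 2 / (4 * r ^ 2) * (freqLaw ρ D).real B ≤ 4 * m₂ := h1.trans_eq (by ring)
    rw [div_mul_eq_mul_div, div_le_iff₀ (by positivity)] at h2
    linarith
  have hincl : {v : Fin D → Pt d | ∃ t, ‖t‖ ≤ δ ∧ ε < |kernelDev ρ v t|}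
      ⊆ (⋃ c ∈ s, {v | ε / 2 ≤ |kernelDev ρ v c|}) ∪ B := by
    rintro v ⟨t, ht, htε⟩
    obtain ⟨c, hc, htc⟩ := hs t ht
    by_cases hvc : ε / 2 ≤ |kernelDev ρ v c|
    · exact Or.inl (Set.mem_biUnion hc hvc)
    · right
      set A : ℝ := (∑ i, ‖v i‖) / D with hA
      have hA0 : 0 ≤ A := by positivity
      have ha0 : 0 ≤ a := integral_nonneg fun w => norm_nonneg _
      have h1 : |kernelDev ρ v t - kernelDev ρ v c| ≤ (A + a) * r :=
        (abs_kernelDev_sub_le hD hL1 v t c).trans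
          (mul_le_mul_of_nonneg_left htc (add_nonneg hA0 ha0))
      have h2 : |kernelDev ρ v t| - |kernelDev ρ v c| ≤ _ := abs_sub_abs_le_abs_sub _ _
      have h3 : ε / 2 ≤ (A + a) * r := by linarith
      have h4 : A ^ 2 ≤ (∑ i, ‖v i‖ ^ 2) / D := by
        have := sq_sum_le_card_mul_sum_sq (s := (Finset.univ : Finset (Fin D)))
          (f := fun i => ‖v i‖)
        rw [Finset.card_univ, Fintype.card_fin] at this
        rw [hA, div_pow, div_le_div_iff₀ (by positivity) hD0]
        nlinarith [this]
      have h5 : (ε / 2) ^ 2 ≤ ((A + a) * r) ^ 2 := by gcongr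
      rw [hB, Set.mem_ofPred_eq, div_le_iff₀ (by positivity)]
      have h6 : (A + a) ^ 2 ≤ 2 * ((∑ i, ‖v i‖ ^ 2) / D) + 2 * m₂ := by
        nlinarith [sq_nonneg (A - a)]
      have h7 := mul_le_mul_of_nonneg_right h6 (by positivity : 0 ≤ 4 * r ^ 2)
      nlinarith [h5, h7]
  refine (measureReal_mono hincl).trans ((measureReal_union_le _ _).trans (add_le_add ?_ hBle))
  refine (measureReal_biUnion_finset_le _ _).trans ?_
  refine (Finset.sum_le_sum fun c _ =>
    measureReal_abs_kernelDev_ge_le hD c (by positivity : 0 ≤ ε / 2)).trans ?_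
  rw [Finset.sum_const, nsmul_eq_mul]
  have e : -(D * (ε / 2) ^ 2) / 2 = -(D * ε ^ 2) / 8 := by ring
  rw [e]
  gcongr

end RandomFeatures

/-! ### Deviation on small balls -/

section SmallDiameter

variable {d D : ℕ} {ρ : Measure (Pt d)} [IsProbabilityMeasure ρ]

/-- The chord of `exp` over `[0, 1]` has slope `e - 1 < 2`. -/
lemma exp_half_le_one_add {y : ℝ} (h0 : 0 ≤ y) (h2 : y ≤ 2) : Real.exp (y / 2) ≤ 1 + y := by
  have h := convexOn_exp.2 (Set.mem_univ (0 : ℝ)) (Set.mem_univ (1 : ℝ))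
    (by linarith : 0 ≤ 1 - y / 2) (by positivity : 0 ≤ y / 2) (by ring)
  simp only [smul_eq_mul, mul_zero, mul_one, zero_add, Real.exp_zero] at h
  nlinarith [Real.exp_one_lt_d9]

lemma exp_mul_sub_one_le {a w : ℝ} (hw : 0 ≤ w) (hw1 : 2 * w ≤ 1) :
    Real.exp (a * w) - 1 ≤ 2 * w * (Real.exp (a / 2) - 1) := by
  have h := convexOn_exp.2 (Set.mem_univ (0 : ℝ)) (Set.mem_univ (a / 2))
    (by linarith : 0 ≤ 1 - 2 * w) (by positivity : 0 ≤ 2 * w) (by ring)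
  simp only [smul_eq_mul, mul_zero, mul_one, zero_add, Real.exp_zero] at h
  rw [show 2 * w * (a / 2) = a * w by ring] at h
  linarith

/-- Uniform deviation bound for balls that are small compared with the scale of the kernel. -/
lemma measureReal_exists_kernelDev_gt_le_of_small (hD : 1 ≤ D)
    (hmom : Integrable (fun w : Pt d => ‖w‖ ^ 2) ρ) {δ ε : ℝ} (hε : 0 < ε) (hε2 : ε ≤ 2)
    (hsmall : (∫ w, ‖w‖ ^ 2 ∂ρ) * δ ^ 2 / ε ^ 2 ≤ 1 / 4) :
    (freqLaw ρ D).real {v | ∃ t, ‖t‖ ≤ δ ∧ ε < |kernelDev ρ v t|}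
      ≤ 4 * ((∫ w, ‖w‖ ^ 2 ∂ρ) * δ ^ 2 / ε ^ 2) * Real.exp (-(D * ε) / 4) := by
  have hD0 : (0 : ℝ) < D := by positivity
  set m₂ : ℝ := ∫ w, ‖w‖ ^ 2 ∂ρ with hm₂
  have hm₂0 : 0 ≤ m₂ := integral_nonneg fun w => sq_nonneg _
  set U : ℝ := m₂ * δ ^ 2 / ε ^ 2 with hU
  have hU0 : 0 ≤ U := by positivity
  have hUm : m₂ * δ ^ 2 / 2 = U * ε ^ 2 / 2 := by rw [hU]; field_simp
  -- `Y w` dominates `1 - cos ⟪w, t⟫` for all `‖t‖ ≤ δ` at once. Truncation at 2 gives exponential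
  -- moments under only a second-moment assumption.
  set Y : Pt d → ℝ := fun w => min (‖w‖ ^ 2 * δ ^ 2 / 2) 2 with hY
  have hYm : Measurable Y := by rw [hY]; fun_prop
  have hY0 : ∀ w, 0 ≤ Y w := fun w => le_min (by positivity) zero_le_two
  have hY2 : ∀ w, Y w ≤ 2 := fun w => min_le_right _ _
  have hYi : Integrable Y ρ := Integrable.of_bound (C := 2) hYm.aestronglyMeasurable
    (ae_of_all _ fun w => by rw [Real.norm_eq_abs, abs_of_nonneg (hY0 w)]; exact hY2 w)
  have hEYi : Integrable (fun w => Real.exp (Y w / 2)) ρ :=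
    Integrable.of_bound (C := Real.exp 1) (by fun_prop) (ae_of_all _ fun w => by
      rw [Real.norm_eq_abs, Real.abs_exp, Real.exp_le_exp]; linarith [hY2 w])
  have hEY : ∫ w, Y w ∂ρ ≤ U * ε ^ 2 / 2 := by
    rw [← hUm, ← integral_mul_const, ← integral_div]
    exact integral_mono hYi ((hmom.mul_const _).div_const _) fun w => min_le_left _ _
  have hmgf : ∫ w, Real.exp (Y w / 2) ∂ρ ≤ Real.exp (U * ε ^ 2 / 2) := by
    calc _ ≤ ∫ w, (1 + Y w) ∂ρ := integral_mono hEYi ((integrable_const _).add hYi)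
            fun w => exp_half_le_one_add (hY0 w) (hY2 w)
      _ = 1 + ∫ w, Y w ∂ρ := by rw [integral_add (integrable_const _) hYi]; simp
      _ ≤ U * ε ^ 2 / 2 + 1 := by linarith
      _ ≤ _ := Real.add_one_le_exp _
  set a : ℝ := D * ε / 2 with ha
  have ha0 : 0 < a := by positivity
  have hprod : (fun v : Fin D → Pt d => Real.exp ((∑ i, Y (v i)) / 2))
      = fun v => ∏ i, Real.exp (Y (v i) / 2) := by
    ext v; rw [← Real.exp_sum, Finset.sum_div]
  have hint : ∫ v, Real.exp ((∑ i, Y (v i)) / 2) ∂(freqLaw ρ D) ≤ Real.exp (a * (U * ε)) := by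
    rw [hprod, freqLaw, integral_fintype_prod_eq_pow (ι := Fin D)
      (f := fun w => Real.exp (Y w / 2)), Fintype.card_fin]
    refine (pow_le_pow_left₀ (integral_nonneg fun w => (Real.exp_pos _).le) hmgf D).trans_eq ?_
    rw [← Real.exp_nat_mul, ha]
    congr 1; ring
  have hinti : Integrable (fun v : Fin D → Pt d => Real.exp ((∑ i, Y (v i)) / 2))
      (freqLaw ρ D) := by
    rw [hprod]
    exact Integrable.fintype_prod (f := fun (_ : Fin D) w => Real.exp (Y w / 2)) fun _ => hEYi
  -- Markov is applied to `exp - 1` rather than `exp`, so the bound vanishes with `U` and yields the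
  -- prefactor `4 * U`.
  have hM := mul_meas_ge_le_integral_of_nonneg (μ := freqLaw ρ D)
    (f := fun v : Fin D → Pt d => Real.exp ((∑ i, Y (v i)) / 2) - 1)
    (ae_of_all _ fun v => by
      have : 0 ≤ ∑ i, Y (v i) := Finset.sum_nonneg fun i _ => hY0 _
      simp only [Pi.zero_apply, sub_nonneg, Real.one_le_exp_iff]
      positivity)
    (hinti.sub (integrable_const 1)) (Real.exp a - 1)
  rw [integral_sub hinti (integrable_const 1)] at hM
  simp only [integral_const, probReal_univ, one_smul] at hM
  set P := (freqLaw ρ D).real {v : Fin D → Pt d |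
    Real.exp a - 1 ≤ Real.exp ((∑ i, Y (v i)) / 2) - 1} with hP
  have hincl : {v : Fin D → Pt d | ∃ t, ‖t‖ ≤ δ ∧ ε < |kernelDev ρ v t|}
      ⊆ {v | Real.exp a - 1 ≤ Real.exp ((∑ i, Y (v i)) / 2) - 1} := by
    rintro v ⟨t, ht, htε⟩
    have hcos : ∀ w : Pt d, 1 - Y w ≤ Real.cos ⟪w, t⟫ := fun w => by
      have h1 := Real.one_sub_sq_div_two_le_cos (x := ⟪w, t⟫)
      have h2 : ⟪w, t⟫ ^ 2 ≤ ‖w‖ ^ 2 * δ ^ 2 := by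
        rw [← mul_pow, ← sq_abs]
        have := (abs_real_inner_le_norm w t).trans
          (mul_le_mul_of_nonneg_left ht (norm_nonneg w))
        gcongr
      rcases min_choice (‖w‖ ^ 2 * δ ^ 2 / 2) 2 with h | h
      · simp only [hY, h]; linarith
      · simp only [hY, h]; linarith [Real.neg_one_le_cos ⟪w, t⟫]
    have hk : 1 - U * ε ^ 2 / 2 ≤ ∫ w, Real.cos ⟪w, t⟫ ∂ρ := by
      have : ∫ w, (1 - Y w) ∂ρ ≤ ∫ w, Real.cos ⟪w, t⟫ ∂ρ :=
        integral_mono ((integrable_const _).sub hYi) (integrable_cos_inner t) hcos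
      rw [integral_sub (integrable_const _) hYi] at this
      simp only [integral_const, probReal_univ, one_smul] at this
      linarith
    have hk1 : ∫ w, Real.cos ⟪w, t⟫ ∂ρ ≤ 1 := by
      rw [← charFun_re]
      exact (Complex.re_le_norm _).trans (norm_charFun_le_one _)
    have hs1 : (∑ i, Real.cos ⟪v i, t⟫) / D ≤ 1 := by
      rw [div_le_one hD0]
      exact (Finset.sum_le_sum fun i _ => Real.cos_le_one _).trans (by simp)
    have hs2 : 1 - (∑ i, Y (v i)) / D ≤ (∑ i, Real.cos ⟪v i, t⟫) / D := by
      have : ∑ i, (1 - Y (v i)) ≤ ∑ i, Real.cos ⟪v i, t⟫ := Finset.sum_le_sum fun i _ => hcos _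
      rw [Finset.sum_sub_distrib] at this
      simp only [Finset.sum_const, Finset.card_univ, Fintype.card_fin, nsmul_eq_mul,
        mul_one] at this
      rw [one_sub_div hD0.ne']
      gcongr
    -- The true kernel thus lies in `[1 - ε, 1]`. The empirical one cannot exceed it by more than
    -- `ε`, so a large deviation forces the average of `Y` above `ε`.
    have hUε : U * ε ^ 2 / 2 ≤ ε := by nlinarith
    rw [kernelDev, lt_abs] at htε
    have hYε : ε ≤ (∑ i, Y (v i)) / D := by
      rcases htε with h | h <;> linarith
    rw [le_div_iff₀ hD0] at hYε
    simp only [Set.mem_ofPred_eq, sub_le_sub_iff_right, Real.exp_le_exp, ha]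
    linarith
  refine (measureReal_mono hincl).trans ?_
  have hw1 : 2 * (U * ε) ≤ 1 := by nlinarith
  have h1 : (Real.exp a - 1) * P ≤ 2 * (U * ε) * (Real.exp (a / 2) - 1) :=
    (hM.trans (sub_le_sub_right hint 1)).trans (exp_mul_sub_one_le (by positivity) hw1)
  have h2 : Real.exp a = Real.exp (a / 2) * Real.exp (a / 2) := by
    rw [← Real.exp_add]; congr 1; ring
  have h3 : 0 < Real.exp (a / 2) - 1 := by
    rw [sub_pos, Real.one_lt_exp_iff]; positivity
  have h4 : (Real.exp (a / 2) + 1) * P ≤ 2 * (U * ε) := by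
    refine le_of_mul_le_mul_right ?_ h3
    calc _ = (Real.exp a - 1) * P := by rw [h2]; ring
      _ ≤ _ := h1
  have hP0 : 0 ≤ P := measureReal_nonneg
  have h5 : Real.exp (a / 2) * P ≤ 4 * U := by nlinarith
  have h6 : -(D * ε) / 4 = -(a / 2) := by rw [ha]; ring
  rw [h6, Real.exp_neg, ← div_eq_mul_inv, le_div_iff₀ (Real.exp_pos _), mul_comm]
  exact h5

end SmallDiameter

/-! ### Combining the two regimes -/

section UniformApproximation

variable {d D : ℕ} {ρ : Measure (Pt d)} [IsProbabilityMeasure ρ]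

/-- Uniform approximation of a shift-invariant kernel by random Fourier features on a ball. -/
theorem measure_exists_kernelDev_gt_le (hD : 1 ≤ D)
    (hmom : Integrable (fun w : Pt d => ‖w‖ ^ 2) ρ) {δ ε : ℝ} (hδ : 0 ≤ δ) (hε : 0 < ε) :
    freqLaw ρ D {v | ∃ t, ‖t‖ ≤ δ ∧ ε < |kernelDev ρ v t|}
      ≤ ENNReal.ofReal (2 ^ 8 * (freqRms ρ * δ / ε) ^ 2
          * Real.exp (-(D * ε ^ 2) / (4 * d + 8))) := by
  have hD0 : (0 : ℝ) < D := by positivity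
  rw [← ofReal_measureReal]
  refine ENNReal.ofReal_le_ofReal ?_
  have hm₂0 : 0 ≤ ∫ w, ‖w‖ ^ 2 ∂ρ := integral_nonneg fun w => sq_nonneg _
  rw [div_pow, mul_pow, freqRms, Real.sq_sqrt hm₂0]
  set m₂ : ℝ := ∫ w, ‖w‖ ^ 2 ∂ρ with hm₂
  set U : ℝ := m₂ * δ ^ 2 / ε ^ 2 with hU
  have hU0 : 0 ≤ U := by positivity
  -- With cover radius `3 δ q`, the cover has at most `q⁻ᵈ` centres, each with Hoeffding factor `q ^
  -- (d + 2)`. Both terms of the cover bound then scale as `q ^ 2`, the target exponential.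
  set q : ℝ := Real.exp (-(D * ε ^ 2) / (8 * d + 16)) with hq
  have hq0 : 0 < q := Real.exp_pos _
  have hqE : Real.exp (-(D * ε ^ 2) / (4 * d + 8)) = q ^ 2 := by
    rw [hq, ← Real.exp_nat_mul]
    congr 1
    field_simp
    push_cast
    ring
  rw [hqE]
  rcases lt_or_ge 2 ε with hε2 | hε2
  · have : {v : Fin D → Pt d | ∃ t, ‖t‖ ≤ δ ∧ ε < |kernelDev ρ v t|} = ∅ := by
      refine Set.eq_empty_of_forall_notMem ?_
      rintro v ⟨t, -, ht⟩
      linarith [abs_kernelDev_le_two (ρ := ρ) hD v t]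
    rw [this, measureReal_empty]
    positivity
  -- Above this threshold a nontrivial target, `256 U q² < 1`, forces `q ≤ 1/3`, so the cover radius
  -- is at most `δ`; moreover `2 + 144 U ≤ 256 U`.
  rcases le_or_gt U (9 / 256) with hUs | hUs
  · refine (measureReal_exists_kernelDev_gt_le_of_small hD hmom hε hε2
      (hUs.trans (by norm_num))).trans ?_
    rw [← hm₂, ← hU, ← hqE]
    have hexp : -(D * ε) / 4 ≤ -(D * ε ^ 2) / (4 * d + 8) := by
      rw [div_le_div_iff₀ (by norm_num) (by positivity)]
      have h1 : D * ε * ε ≤ D * ε * 2 := by gcongr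
      have h2 : 0 ≤ D * ε * d := by positivity
      nlinarith
    exact mul_le_mul (mul_le_mul_of_nonneg_right (by norm_num) hU0) (Real.exp_le_exp.2 hexp)
      (Real.exp_pos _).le (by positivity)
  rcases le_or_gt 1 (2 ^ 8 * U * q ^ 2) with h1 | h1
  · exact measureReal_le_one.trans h1
  have hq3 : 3 * q ≤ 1 := by
    have : (3 * q) ^ 2 ≤ 1 := by nlinarith [sq_nonneg q]
    exact (abs_le_one_iff_mul_self_le_one.2 (by rwa [← sq])).trans' (le_abs_self _)
  have hδ0 : 0 < δ := by
    rcases hδ.eq_or_lt with h | h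
    · rw [hU, ← h] at hUs; norm_num at hUs
    · exact h
  refine (measureReal_exists_kernelDev_gt_le_of_cover hD hmom (r := 3 * δ * q) (by positivity)
    (by nlinarith) hε).trans ?_
  rw [← hm₂]
  have e1 : Real.exp (-(D * ε ^ 2) / 8) = q ^ (d + 2) := by
    rw [hq, ← Real.exp_nat_mul]
    congr 1
    push_cast
    field_simp
    ring
  have e2 : (3 * δ / (3 * δ * q)) ^ d * (2 * q ^ (d + 2)) = 2 * q ^ 2 := by
    rw [div_mul_cancel_left₀ (by positivity), inv_pow, pow_add]
    field_simp
  have e3 : 16 * m₂ * (3 * δ * q) ^ 2 / ε ^ 2 = 144 * U * q ^ 2 := by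
    rw [hU]; ring
  rw [e1, e2, e3]
  have : 0 < q ^ 2 := by positivity
  nlinarith

end UniformApproximation

/-! ### Regret bounds and their logarithmic rate -/

section Regret

variable {d D : ℕ} {𝒳 : Set (Pt d)} {kbar : Pt d → Pt d → ℝ} {ρ : Measure (Pt d)}
  [IsProbabilityMeasure ρ] {σθ : ℝ} {f : Pt d → ℝ} {ℓ : ℝ → ℝ → ℝ} {c₄ L C : ℝ}
  {v : Fin D → Pt d} {T : ℕ} {x : ℕ → Pt d} {α : ℕ → ℝ}

lemma regret_rfWeight_le (hD : 1 ≤ D) (hσθ : 0 < σθ)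
    (hsmooth : ∀ x ∈ 𝒳, ContDiff ℝ 2 fun z => ℓ z (f x))
    (hconvex : ∀ x ∈ 𝒳, ConvexOn ℝ Set.univ fun z => ℓ z (f x))
    (hc₄ : ∀ x ∈ 𝒳, ∀ z, |iteratedDeriv 2 (fun z => ℓ z (f x)) z| ≤ c₄)
    (hx : ∀ t < T, x t ∈ 𝒳) (hα : ∑ s ∈ Finset.range T, σθ ^ 2 * |α s| ≤ C) :
    ∑ t ∈ Finset.range T, bayesLoss ℓ σθ v x (fun t => f (x t)) t
        - ∑ t ∈ Finset.range T, ℓ (feature v (x t) ⬝ᵥ rfWeight σθ v x α T) (f (x t))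
      ≤ C ^ 2 / (2 * σθ ^ 2) + D * Real.log (1 + T * c₄ * σθ ^ 2 / (2 * D)) := by
  have h1 := sum_bayesLoss_le (v := v) (x := x) (y := fun t => f (x t)) hD hσθ
    (fun t ht => hsmooth _ (hx t ht)) (fun t ht => hconvex _ (hx t ht))
    (fun t ht => hc₄ _ (hx t ht)) (rfWeight σθ v x α T)
  have h2 : rfWeight σθ v x α T ⬝ᵥ rfWeight σθ v x α T / (2 * σθ ^ 2) ≤ C ^ 2 / (2 * σθ ^ 2) := by
    gcongr
    exact rfWeight_dotProduct_self_le hα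
  linarith

lemma regret_expansion_le (h𝒳 : Bornology.IsBounded 𝒳)
    (hspec : ∀ x x', charFun ρ (x - x') = (kbar x x' : ℂ)) (hD : 1 ≤ D) (hσθ : 0 < σθ)
    (hsmooth : ∀ x ∈ 𝒳, ContDiff ℝ 2 fun z => ℓ z (f x))
    (hconvex : ∀ x ∈ 𝒳, ConvexOn ℝ Set.univ fun z => ℓ z (f x))
    (hc₄ : ∀ x ∈ 𝒳, ∀ z, |iteratedDeriv 2 (fun z => ℓ z (f x)) z| ≤ c₄)
    (hL : ∀ x ∈ 𝒳, ∀ z, |z| ≤ C → |deriv (fun z => ℓ z (f x)) z| ≤ L)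
    {ε : ℝ} (hε : 0 < ε) (hv : ∀ t, ‖t‖ ≤ Metric.diam 𝒳 → |kernelDev ρ v t| ≤ ε)
    (hx : ∀ t < T, x t ∈ 𝒳) {fhat : Pt d → ℝ}
    (hfhat : ∀ t < T, fhat (x t) = ∑ s ∈ Finset.range T, α s * (σθ ^ 2 * kbar (x t) (x s)))
    (hα : ∑ s ∈ Finset.range T, σθ ^ 2 * |α s| ≤ C) :
    ∑ t ∈ Finset.range T, bayesLoss ℓ σθ v x (fun t => f (x t)) t
        - ∑ t ∈ Finset.range T, ℓ (fhat (x t)) (f (x t))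
      ≤ (1 + ε) * C ^ 2 / (2 * σθ ^ 2)
        + D * Real.log (1 + T * c₄ * σθ ^ 2 / (2 * D)) + ε * L * T * C := by
  have h1 := regret_rfWeight_le (v := v) (α := α) hD hσθ hsmooth hconvex hc₄ hx hα
  have hC : 0 ≤ C := (Finset.sum_nonneg fun s _ => by positivity).trans hα
  have h2 : ∀ t ∈ Finset.range T,
      ℓ (feature v (x t) ⬝ᵥ rfWeight σθ v x α T) (f (x t)) - ℓ (fhat (x t)) (f (x t))
        ≤ ε * L * C := by
    intro t ht
    have ht := Finset.mem_range.1 ht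
    have hL0 : 0 ≤ L := (abs_nonneg _).trans (hL _ (hx t ht) 0 (by simpa using hC))
    have ha : |feature v (x t) ⬝ᵥ rfWeight σθ v x α T| ≤ C := by
      rw [feature_dotProduct_rfWeight]
      exact (abs_expansion_le zero_le_one (fun s _ => abs_feature_dotProduct_le_one _ _ _)
        hα).trans_eq (mul_one C)
    have hb : |fhat (x t)| ≤ C := by
      rw [hfhat t ht]
      exact (abs_expansion_le zero_le_one (fun s _ => abs_kernel_le_one hspec _ _)
        hα).trans_eq (mul_one C)
    have hab : |feature v (x t) ⬝ᵥ rfWeight σθ v x α T - fhat (x t)| ≤ C * ε := by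
      rw [feature_dotProduct_rfWeight, hfhat t ht, ← Finset.sum_sub_distrib]
      simp only [← mul_sub]
      refine abs_expansion_le hε.le (fun s hs => ?_) hα
      rw [feature_dotProduct, kernel_eq_integral_cos hspec]
      refine hv _ ?_
      rw [← dist_eq_norm]
      exact Metric.dist_le_diam_of_mem h𝒳 (hx t ht) (hx s hs)
    calc _ ≤ L * |feature v (x t) ⬝ᵥ rfWeight σθ v x α T - fhat (x t)| :=
          sub_le_of_abs_deriv_le (g := fun z => ℓ z (f (x t)))
            ((hsmooth _ (hx t ht)).differentiable (by norm_num)) (hL _ (hx t ht)) ha hb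
      _ ≤ L * (C * ε) := mul_le_mul_of_nonneg_left hab hL0
      _ = ε * L * C := by ring
  have h3 := Finset.sum_le_sum h2
  rw [Finset.sum_sub_distrib, Finset.sum_const, Finset.card_range, nsmul_eq_mul] at h3
  -- The factor `1 + ε` is slack: the bound on `‖θ^*‖` holds without kernel approximation.
  have h4 : C ^ 2 / (2 * σθ ^ 2) ≤ (1 + ε) * C ^ 2 / (2 * σθ ^ 2) := by
    gcongr
    nlinarith [sq_nonneg C]
  linarith

/-- The finitely many exceptional horizons are absorbed by adding their ratios to the constant; `T ≥
2` keeps the denominators positive. -/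
lemma exists_forall_le_mul_log_div {ε : ℕ → ℝ}
    (hO : ε =O[atTop] fun T : ℕ => Real.log T / T) :
    ∃ A : ℝ, 0 ≤ A ∧ ∀ T : ℕ, 2 ≤ T → ε T ≤ A * (Real.log T / T) := by
  obtain ⟨c, hc⟩ := hO.bound
  obtain ⟨N, hN⟩ := eventually_atTop.1 hc
  have hpos : ∀ T : ℕ, 2 ≤ T → 0 < Real.log T / T := fun T hT => by
    have : (1 : ℝ) < T := by exact_mod_cast hT
    have := Real.log_pos this
    positivity
  have hsum : 0 ≤ ∑ T ∈ Finset.range N, |ε T / (Real.log T / T)| :=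
    Finset.sum_nonneg fun _ _ => abs_nonneg _
  refine ⟨|c| + ∑ T ∈ Finset.range N, |ε T / (Real.log T / T)|, by positivity, fun T hT => ?_⟩
  have h0 := hpos T hT
  rcases lt_or_ge T N with h | h
  · rw [← div_le_iff₀ h0]
    have := Finset.single_le_sum (f := fun T : ℕ => |ε T / (Real.log T / T)|)
      (fun _ _ => abs_nonneg _) (Finset.mem_range.2 h)
    linarith [le_abs_self (ε T / (Real.log T / T)), abs_nonneg c]
  · have := hN T h
    rw [Real.norm_eq_abs, Real.norm_eq_abs, abs_of_pos h0] at this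
    refine (le_abs_self _).trans (this.trans (mul_le_mul_of_nonneg_right ?_ h0.le))
    linarith [le_abs_self c]

/-- Constants are absorbed through `log T ≥ log 2` and `D ≥ 1`. The absolute value lets one estimate
serve both regrets without knowing the sign of `L * C`. -/
lemma regret_bound_le_mul_log {σ c₄ L C A ε : ℝ} (hσ : 0 < σ) (hc₄ : 0 ≤ c₄) (hA : 0 ≤ A)
    (hD : 1 ≤ D) (hT : 2 ≤ T) (hε0 : 0 < ε) (hε : ε ≤ A * (Real.log T / T)) :
    (1 + ε) * C ^ 2 / (2 * σ ^ 2) + D * Real.log (1 + T * c₄ * σ ^ 2 / (2 * D))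
        + |ε * L * T * C|
      ≤ ((1 + A) * C ^ 2 / (2 * σ ^ 2) / Real.log 2
          + (1 + Real.log (1 + |c₄| * σ ^ 2) / Real.log 2) + A * |L| * |C|) * D * Real.log T := by
  have hD1 : (1 : ℝ) ≤ D := by exact_mod_cast hD
  have hT2 : (2 : ℝ) ≤ T := by exact_mod_cast hT
  have hl2 : 0 < Real.log 2 := Real.log_pos (by norm_num)
  have hlT : Real.log 2 ≤ Real.log T := Real.log_le_log (by norm_num) hT2
  have hlT0 : 0 < Real.log T := hl2.trans_le hlT
  have hDl : Real.log T ≤ D * Real.log T := le_mul_of_one_le_left hlT0.le hD1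
  have hratio : 1 ≤ Real.log T / Real.log 2 := (one_le_div hl2).2 hlT
  have hεA : ε ≤ A := hε.trans (mul_le_of_le_one_right hA
    (div_le_one_of_le₀ (Real.log_le_self (by linarith)) (by linarith)))
  have hscale : ∀ b : ℝ, 0 ≤ b → b ≤ b / Real.log 2 * (D * Real.log T) := fun b hb => by
    rw [div_mul_eq_mul_div, le_div_iff₀ hl2]
    exact mul_le_mul_of_nonneg_left (hlT.trans hDl) hb
  have h1 : (1 + ε) * C ^ 2 / (2 * σ ^ 2)
      ≤ (1 + A) * C ^ 2 / (2 * σ ^ 2) / Real.log 2 * (D * Real.log T) := by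
    refine le_trans ?_ (hscale _ (by positivity))
    gcongr
  have h2 : Real.log (1 + T * c₄ * σ ^ 2 / (2 * D))
      ≤ (1 + Real.log (1 + |c₄| * σ ^ 2) / Real.log 2) * Real.log T := by
    rw [abs_of_nonneg hc₄]
    have hb : 0 ≤ T * c₄ * σ ^ 2 := by positivity
    have hd : T * c₄ * σ ^ 2 / (2 * D) ≤ T * c₄ * σ ^ 2 := div_le_self hb (by linarith)
    have hl : 0 ≤ Real.log (1 + c₄ * σ ^ 2) :=
      Real.log_nonneg (by linarith [mul_nonneg hc₄ (sq_nonneg σ)])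
    calc _ ≤ Real.log (T * (1 + c₄ * σ ^ 2)) := by
          refine Real.log_le_log (by positivity) ?_
          linarith
      _ = Real.log T + Real.log (1 + c₄ * σ ^ 2) :=
          Real.log_mul (by positivity) (by positivity)
      _ ≤ Real.log T + Real.log (1 + c₄ * σ ^ 2) * (Real.log T / Real.log 2) := by
          linarith [le_mul_of_one_le_right hl hratio]
      _ = _ := by ring
  have h3 : |ε * L * T * C| ≤ A * |L| * |C| * (D * Real.log T) := by
    rw [abs_mul, abs_mul, abs_mul, abs_of_pos hε0, Nat.abs_cast]
    have hεT : ε * T ≤ A * Real.log T := by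
      rw [← mul_div_assoc, le_div_iff₀ (by linarith)] at hε
      exact hε
    calc ε * |L| * T * |C| = ε * T * (|L| * |C|) := by ring
      _ ≤ A * (D * Real.log T) * (|L| * |C|) := by
          have := mul_le_mul_of_nonneg_left hDl hA
          exact mul_le_mul_of_nonneg_right (hεT.trans this) (by positivity)
      _ = _ := by ring
  have h2' := mul_le_mul_of_nonneg_left h2 (by linarith : (0 : ℝ) ≤ D)
  linarith

end Regret

end RFGP

theorem theorem2
    {d : ℕ}
    -- the bounded domain that contains all inputs
    (𝒳 : Set (RFGP.Pt d)) (h𝒳 : Bornology.IsBounded 𝒳)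
    -- a shift-invariant standardized kernel bounded by 1, and the law of its random frequencies,
    -- i.e. the probability measure whose Fourier transform is the kernel
    (kbar : RFGP.Pt d → RFGP.Pt d → ℝ)
    (hshift : ∀ x x' h, kbar (x + h) (x' + h) = kbar x x')
    (hstd : ∀ x, kbar x x = 1)
    (hbdd : ∀ x x', kbar x x' ≤ 1)
    (ρ : Measure (RFGP.Pt d)) [IsProbabilityMeasure ρ]
    (hspec : ∀ x x', charFun ρ (x - x') = (kbar x x' : ℂ))
    (hmom : Integrable (fun v => ‖v‖ ^ 2) ρ)
    -- the reproducing kernel Hilbert space of `k^* = σθ² kbar`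
    (σθ : ℝ) (hσθ : 0 < σθ)
    {H : Type*} [NormedAddCommGroup H] [InnerProductSpace ℝ H] [CompleteSpace H]
    [RKHS ℝ H (RFGP.Pt d) ℝ]
    (hH : ∀ x x', RKHS.kernel H x x' 1 = σθ ^ 2 * kbar x x')
    -- the true function, the loss `ℓ z y` (the negative log-likelihood) and its properties
    (f : RFGP.Pt d → ℝ) (ℓ : ℝ → ℝ → ℝ) (c₄ L C : ℝ)
    (hsmooth : ∀ x ∈ 𝒳, ContDiff ℝ 2 fun z => ℓ z (f x))
    (hconvex : ∀ x ∈ 𝒳, ConvexOn ℝ Set.univ fun z => ℓ z (f x))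
    (hc₄ : ∀ x ∈ 𝒳, ∀ z, |iteratedDeriv 2 (fun z => ℓ z (f x)) z| ≤ c₄)
    (hL : ∀ x ∈ 𝒳, ∀ z, |z| ≤ C → |deriv (fun z => ℓ z (f x)) z| ≤ L) :
    -- every element of the RKHS, in particular an optimal one, is a kernel expansion at the inputs
    (∀ (T : ℕ) (x : ℕ → RFGP.Pt d) (fhat : H), ∃ α : ℕ → ℝ, ∀ t < T,
      fhat (x t) = ∑ s ∈ Finset.range T, α s * (σθ ^ 2 * kbar (x t) (x s))) ∧
    -- the regret bound, simultaneously for all horizons, inputs and comparators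
    (∀ D : ℕ, 1 ≤ D → ∀ ε : ℝ, 0 < ε →
      RFGP.freqLaw ρ D {v | ¬ ∀ (T : ℕ) (x : ℕ → RFGP.Pt d), (∀ t < T, x t ∈ 𝒳) →
        ∀ (fhat : H) (α : ℕ → ℝ),
          (∀ t < T, fhat (x t) = ∑ s ∈ Finset.range T, α s * (σθ ^ 2 * kbar (x t) (x s))) →
          ∑ s ∈ Finset.range T, σθ ^ 2 * |α s| ≤ C →
          ∑ t ∈ Finset.range T, RFGP.bayesLoss ℓ σθ v x (fun t => f (x t)) t
              - ∑ t ∈ Finset.range T, ℓ (fhat (x t)) (f (x t))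
            ≤ (1 + ε) * C ^ 2 / (2 * σθ ^ 2)
              + D * Real.log (1 + T * c₄ * σθ ^ 2 / (2 * D)) + ε * L * T * C}
        ≤ ENNReal.ofReal (RFGP.failProb ρ 𝒳 D ε)) ∧
    -- with `ε T = O(log T / T)` both regrets are `O(log T)`, uniformly in the data
    (∀ ε : ℕ → ℝ, (∀ T, 0 < ε T) → (ε =O[atTop] fun T : ℕ => Real.log T / T) →
      ∃ K : ℝ, ∀ D : ℕ, 1 ≤ D → ∀ T : ℕ, 2 ≤ T →
        RFGP.freqLaw ρ D {v | ¬ ∀ x : ℕ → RFGP.Pt d, (∀ t < T, x t ∈ 𝒳) →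
          ∀ (fhat : H) (α : ℕ → ℝ),
            (∀ t < T, fhat (x t) = ∑ s ∈ Finset.range T, α s * (σθ ^ 2 * kbar (x t) (x s))) →
            ∑ s ∈ Finset.range T, σθ ^ 2 * |α s| ≤ C →
            ∑ t ∈ Finset.range T, RFGP.bayesLoss ℓ σθ v x (fun t => f (x t)) t
                - ∑ t ∈ Finset.range T, ℓ (fhat (x t)) (f (x t)) ≤ K * D * Real.log T ∧
            ∑ t ∈ Finset.range T, RFGP.bayesLoss ℓ σθ v x (fun t => f (x t)) t
                - ∑ t ∈ Finset.range T,
                    ℓ (RFGP.feature v (x t) ⬝ᵥ RFGP.rfWeight σθ v x α T) (f (x t))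
              ≤ K * D * Real.log T}
          ≤ ENNReal.ofReal (RFGP.failProb ρ 𝒳 D (ε T))) ∧
    -- for Gaussian noise the predictor is the recursively updated mean and variance
    (∀ (D : ℕ) (σn : ℝ), 0 < σn →
      ∀ (v : Fin D → RFGP.Pt d) (x : ℕ → RFGP.Pt d) (y : ℕ → ℝ) (t : ℕ),
        let μ := RFGP.feature v (x t) ⬝ᵥ (RFGP.orfgp σθ σn v x y t).1
        let s := RFGP.predVar σn v (RFGP.orfgp σθ σn v x y t).2 (x t)
        RFGP.bayesLoss (RFGP.gaussianLoss σn) σθ v x y t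
          = (y t - μ) ^ 2 / (2 * s) + Real.log (2 * Real.pi * s) / 2) := by
  -- Any property implied by uniform kernel closeness fails only inside the deviation event.
  -- Monotonicity suffices, so the failure set need not be measurable.
  have hsub : ∀ (D : ℕ) (ε : ℝ) (Q : (Fin D → RFGP.Pt d) → Prop), 1 ≤ D → 0 < ε →
      (∀ v : Fin D → RFGP.Pt d,
        (∀ t, ‖t‖ ≤ Metric.diam 𝒳 → |RFGP.kernelDev ρ v t| ≤ ε) → Q v) →
      RFGP.freqLaw ρ D {v | ¬ Q v} ≤ ENNReal.ofReal (RFGP.failProb ρ 𝒳 D ε) := by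
    intro D ε Q hD hε hQ
    refine le_trans (measure_mono fun v hv => ?_)
      (RFGP.measure_exists_kernelDev_gt_le hD hmom Metric.diam_nonneg hε)
    by_contra hcon
    exact hv (hQ v fun t ht => not_lt.1 fun hlt => hcon ⟨t, ht, hlt⟩)
  refine ⟨fun T x fhat => ?_, fun D hD ε hε => ?_, fun ε hε hO => ?_, fun D σn hσn v x y t =>
    RFGP.bayesLoss_gaussianLoss hσn σθ v x y t⟩
  · obtain ⟨α, hα⟩ := RFGP.exists_kernel_expansion T x fhat
    exact ⟨α, fun t ht => by simp only [hα t ht, hH]⟩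
  · refine hsub D ε _ hD hε fun v hv T x hx fhat α hfhat hα => ?_
    exact RFGP.regret_expansion_le h𝒳 hspec hD hσθ hsmooth hconvex hc₄ hL hε hv hx hfhat hα
  · obtain ⟨A, hA, hεA⟩ := RFGP.exists_forall_le_mul_log_div hO
    refine ⟨(1 + A) * C ^ 2 / (2 * σθ ^ 2) / Real.log 2
      + (1 + Real.log (1 + |c₄| * σθ ^ 2) / Real.log 2) + A * |L| * |C|, fun D hD T hT => ?_⟩
    refine hsub D (ε T) _ hD (hε T) fun v hv x hx fhat α hfhat hα => ?_
    -- Since `T ≥ 2`, the input `x 0` witnesses that `𝒳` is nonempty.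
    have hc₄0 : 0 ≤ c₄ := (abs_nonneg _).trans (hc₄ _ (hx 0 (by omega)) 0)
    have hbound := RFGP.regret_bound_le_mul_log (L := L) (C := C) hσθ hc₄0 hA hD hT (hε T)
      (hεA T hT)
    have h1 := RFGP.regret_expansion_le h𝒳 hspec hD hσθ hsmooth hconvex hc₄ hL (hε T) hv hx
      hfhat hα
    have h2 := RFGP.regret_rfWeight_le (v := v) hD hσθ hsmooth hconvex hc₄ hx hα
    have h3 : C ^ 2 / (2 * σθ ^ 2) ≤ (1 + ε T) * C ^ 2 / (2 * σθ ^ 2) := by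
      gcongr
      nlinarith [sq_nonneg C, hε T]
    have h4 := le_abs_self (ε T * L * T * C)
    have h5 := abs_nonneg (ε T * L * T * C)
    exact ⟨by linarith, by linarith⟩
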